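/- **Setting.** A weight matrix is a family $\mathcal M=\{\mathbb M^{(p)}:p>0\}$, indexed by the positive real numbers, of sequences $\mathbb M^{(p)}=(M^{(p)}_j)_{j\ge 0}$ of positive real numbers with $M^{(p)}_0=1$ and $M^{(p)}_j\le M^{(q)}_j$ for all $j$ whenever $p\le q$. Write $\check M^{(p)}_j=M^{(p)}_j/j!$. Two sequences $\mathbb M,\mathbb L$ of positive numbers satisfy $\mathbb M\preceq\mathbb L$ if there are $A,B>0$ with $M_j\le AB^jL_j$ for all $j\ge0$; they are equivalent if $\mathbb M\preceq\mathbb L$ and $\mathbb L\preceq\mathbb M$. A sequence $\mathbb L$ is log-convex if $L_j^2\le L_{j-1}L_{j+1}$ for all $j\ge1$. Consider the following conditions. * $(\mathcal M_{\{\mathrm{rai}\}})$: for every $p>0$ there are $C>0$ and $q>0$ such that $(\check M^{(p)}_j)^{1/j}\le C(\check M^{(q)}_k)^{1/k}$ for all $1\le j\le k$. * $(\mathcal M_{\{C^\omega\}})$: there is $p>0$ with $\liminf_{j\to\infty}(\check M^{(p)}_j)^{1/j}>0$. * $(\mathcal M_{\{\mathrm{dc}\}})$: for every $p>0$ there are $C>0$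 and $q>0$ such that $M^{(p)}_{j+1}\le C^{j+1}M^{(q)}_j$ for all $j\ge0$. * $(\mathcal M_{\{\mathrm{FdB}\}})$: for every $p>0$ there is $q>0$ with $(\check{\mathbb M}^{(p)})^\circ\preceq\check{\mathbb M}^{(q)}$, where $(\check{\mathbb M}^{(p)})^\circ_0=1$ and, for $k\ge1$, $(\check{\mathbb M}^{(p)})^\circ_k=\max\{\check M^{(p)}_\ell\check M^{(p)}_{j_1}\cdots\check M^{(p)}_{j_\ell}: \ell\ge 1,\ j_i\ge1,\ j_1+\dots+j_\ell=k\}$. For $\alpha>0$ let $S_\alpha=\{z:|\arg z|<\alpha\pi/2\}$, a sector in the Riemann surface of the logarithm. Let $\mathcal A_{\{\mathcal M\}}(S_\alpha)$ be the set of holomorphic functions $f$ on $S_\alpha$ such that, for some $p>0$ and $h>0$, $\sup_{z\in S_\alpha,\,j\ge0}|f^{(j)}(z)|/(h^jM^{(p)}_j)<\infty$. For an open set $U\subseteq\mathbb C$ let $\mathcal H(U)$ be the set of holomorphic functions on $U$, and let $\mathcal H_{\{\mathcal M\}}(U)$ be the set of those $g\in\mathcal H(U)$ such that for every compact $K\subset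 U$ there are $p>0$ and $h>0$ with $\sup_{z\in K,\,j\ge0}|g^{(j)}(z)|/(h^jM^{(p)}_j)<\infty$. The class $\mathcal A_{\{\mathcal M\}}(S_\alpha)$ is called * *holomorphically closed* if $g\circ f\in\mathcal A_{\{\mathcal M\}}(S_\alpha)$ for all $f\in\mathcal A_{\{\mathcal M\}}(S_\alpha)$ and all $g\in\mathcal H(U)$, where $U\subseteq\mathbb C$ is any open set containing the closure of the range of $f$; * *inverse-closed* if $1/f\in\mathcal A_{\{\mathcal M\}}(S_\alpha)$ for all $f\in\mathcal A_{\{\mathcal M\}}(S_\alpha)$ with $\inf_{z\in S_\alpha}|f(z)|>0$; * *closed under composition* if $g\circ f\in\mathcal A_{\{\mathcal M\}}(S_\alpha)$ for all $f\in\mathcal A_{\{\mathcal M\}}(S_\alpha)$ and all $g\in\mathcal H_{\{\mathcal M\}}(U)$, where $U\subseteq\mathbb C$ is any open set containing the closure of the range of $f$. **Theorem.** Let $\mathcal M=\{\mathbb M^{(p)}:p>0\}$ be a weight matrix and let $\alpha>1$. Suppose that for each $p>0$ there is some $\alpha_p>\alpha$ such that the sequence $\bigl(j^{(1-\alpha_p)j}M^{(p)}_j\bigr)_{j\ge0}$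 (with $0^0=1$) is equivalent to a log-convex sequence $\mathbb L^{(p)}$ of positive numbers. Then the following are equivalent: (a) $\mathcal M$ satisfies $(\mathcal M_{\{\mathrm{rai}\}})$; (b) $\mathcal A_{\{\mathcal M\}}(S_\alpha)$ is holomorphically closed; (c) $\mathcal A_{\{\mathcal M\}}(S_\alpha)$ is inverse-closed. If in addition $\mathcal M$ satisfies $(\mathcal M_{\{C^\omega\}})$ and $(\mathcal M_{\{\mathrm{dc}\}})$, then (a), (b), (c) are also equivalent to each of the following: (d) $\mathcal A_{\{\mathcal M\}}(S_\alpha)$ is closed under composition; (e) $\mathcal M$ satisfies $(\mathcal M_{\{\mathrm{FdB}\}})$. -/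

import Mathlib

open Filter

/-! ### Sequences of positive real numbers -/

namespace Ultraholomorphic

/-- Index set of positive real numbers. -/
abbrev Index : Type := Set.Ioi (0 : ℝ)

/-- A weight matrix: a family of sequences `M p` of positive numbers with `M p 0 = 1`, indexed by
the real numbers `p > 0`, and pointwise nondecreasing in `p`. -/
structure WeightMatrix where
  seq : Index → ℕ → ℝ
  pos : ∀ p j, 0 < seq p j
  zero : ∀ p, seq p 0 = 1
  mono : ∀ p q, p ≤ q → ∀ j, seq p j ≤ seq q j

/-- The sequence `M_j / j!`. -/
noncomputable def check (M : ℕ → ℝ) (j : ℕ) : ℝ := M j / (j.factorial : ℝ)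

/-- The sequence `j ^ (j * a)`, with the convention `0 ^ 0 = 1`. -/
noncomputable def gevreyBar (a : ℝ) (j : ℕ) : ℝ := (j : ℝ) ^ ((j : ℝ) * a)

/-- Log-convexity: `M_j ^ 2 ≤ M_{j-1} * M_{j+1}` for all `j ≥ 1`. -/
def LogConvex (M : ℕ → ℝ) : Prop := ∀ j : ℕ, M (j + 1) ^ 2 ≤ M j * M (j + 2)

/-- The relation `M ≼ L`: there are `A, B > 0` with `M_j ≤ A * B ^ j * L_j` for all `j`. -/
def Preceq (M L : ℕ → ℝ) : Prop :=
  ∃ A B : ℝ, 0 < A ∧ 0 < B ∧ ∀ j : ℕ, M j ≤ A * B ^ j * L j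

/-- Equivalence of sequences. -/
def Equivalent (M L : ℕ → ℝ) : Prop := Preceq M L ∧ Preceq L M

/-- For a sequence `N`, the sequence with value `1` at `0` whose value at `k ≥ 1` is the maximum of
`N_ℓ * N_{j_1} * ⋯ * N_{j_ℓ}` over all compositions `k = j_1 + ⋯ + j_ℓ` with all `j_i ≥ 1`. -/
noncomputable def circ (N : ℕ → ℝ) (k : ℕ) : ℝ :=
  if k = 0 then 1 else
    (Finset.univ : Finset (Composition k)).sup' Finset.univ_nonempty
      (fun c => N c.length * ∏ i : Fin c.length, N (c.blocksFun i))

/-! ### Conditions on weight matrices (of Roumieu type) -/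

namespace WeightMatrix

/-- For some index, `liminf (M_j / j!) ^ (1 / j) > 0` (the lower limit is taken in `[0, ∞]`). -/
def HasComega (M : WeightMatrix) : Prop :=
  ∃ p : Index,
    0 < liminf (fun j : ℕ => ENNReal.ofReal (check (M.seq p) j ^ (1 / (j : ℝ)))) atTop

/-- Derivation closedness. -/
def HasDc (M : WeightMatrix) : Prop :=
  ∀ p : Index, ∃ C : ℝ, 0 < C ∧ ∃ q : Index, ∀ j : ℕ, M.seq p (j + 1) ≤ C ^ (j + 1) * M.seq q j

/-- The root almost increasing property. -/
def HasRai (M : WeightMatrix) : Prop :=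
  ∀ p : Index, ∃ C : ℝ, 0 < C ∧ ∃ q : Index, ∀ j k : ℕ, 1 ≤ j → j ≤ k →
    check (M.seq p) j ^ (1 / (j : ℝ)) ≤ C * check (M.seq q) k ^ (1 / (k : ℝ))

/-- The Faà di Bruno property. -/
def HasFdB (M : WeightMatrix) : Prop :=
  ∀ p : Index, ∃ q : Index, Preceq (circ (check (M.seq p))) (check (M.seq q))

end WeightMatrix

/-! ### The Riemann surface of the logarithm -/

/-- A point of the Riemann surface of the logarithm, given by its logarithm. The logarithm is a
global holomorphic chart onto `ℂ`, and its imaginary part is the argument of the point. -/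
structure LogSurface where
  log : ℂ

namespace LogSurface

/-- The argument of a point, an arbitrary real number. -/
def arg (z : LogSurface) : ℝ := z.log.im

/-- The covering projection to the punctured plane. -/
noncomputable def proj (z : LogSurface) : ℂ := Complex.exp z.log

/-- The unbounded sector of opening `α * π` bisected by the direction `0`. -/
def sector (α : ℝ) : Set LogSurface := {z | |z.arg| < α * Real.pi / 2}

/-- Holomorphy on a set, in the global chart. -/
def HolomorphicOn (f : LogSurface → ℂ) (S : Set LogSurface) : Prop :=
  DifferentiableOn ℂ (fun w : ℂ => f ⟨w⟩) {w : ℂ | (⟨w⟩ : LogSurface) ∈ S}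

/-- The complex derivative `df/dz` with respect to the variable `z = exp w` (and not with respect
to the chart `w = log z`), which by the chain rule is `exp (-w) * d/dw`. -/
noncomputable def zderiv (f : LogSurface → ℂ) (z : LogSurface) : ℂ :=
  Complex.exp (-z.log) * deriv (fun w : ℂ => f ⟨w⟩) z.log

/-- The lift of a function of a planar variable has the lifted derivative. -/
theorem zderiv_comp_proj (g : ℂ → ℂ) (z : LogSurface) (hg : DifferentiableAt ℂ g z.proj) :
    zderiv (fun ζ => g ζ.proj) z = deriv g z.proj := by
  have h := (hg.hasDerivAt.comp z.log (Complex.hasDerivAt_exp z.log)).deriv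
  have h' : deriv (fun w : ℂ => g (Complex.exp w)) z.log
      = deriv g (Complex.exp z.log) * Complex.exp z.log := h
  simp only [zderiv, proj]
  rw [h', mul_comm, mul_assoc, ← Complex.exp_add]
  simp

end LogSurface

open LogSurface

/-! ### Ultraholomorphic classes and stability properties

Functions on an open set are represented by total functions. Values outside the set are irrelevant,
since holomorphy and all derivatives at points of an open set only depend on the values there. -/

/-- Membership in the class of the sequence `M` with parameter `h` on `S`: `f` is holomorphic on `S`
and the numbers `|f^(j)(z)| / (h^j M_j)`, `z ∈ S`, `j ≥ 0`, are bounded. -/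
def classSeqH (M : ℕ → ℝ) (h : ℝ) (S : Set LogSurface) : Set (LogSurface → ℂ) :=
  {f | HolomorphicOn f S ∧
    ∃ C : ℝ, ∀ z ∈ S, ∀ j : ℕ, ‖(zderiv^[j] f) z‖ / (h ^ j * M j) ≤ C}

/-- The Roumieu class of the sequence `M` on `S`. -/
def classSeq (M : ℕ → ℝ) (S : Set LogSurface) : Set (LogSurface → ℂ) :=
  {f | ∃ h : ℝ, 0 < h ∧ f ∈ classSeqH M h S}

/-- The Roumieu class of the weight matrix `M` on `S`. -/
def classMatrix (M : WeightMatrix) (S : Set LogSurface) : Set (LogSurface → ℂ) :=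
  {f | ∃ p : Index, f ∈ classSeq (M.seq p) S}

/-- The class of holomorphic functions on a plane open set `U` for which every compact `K ⊆ U`
admits an index `p` and an `h > 0` such that `|g^(j)(z)| / (h^j M^(p)_j)` is bounded for `z ∈ K`,
`j ≥ 0`. -/
def planeClassMatrix (M : WeightMatrix) (U : Set ℂ) : Set (ℂ → ℂ) :=
  {g | DifferentiableOn ℂ g U ∧ ∀ K : Set ℂ, IsCompact K → K ⊆ U →
    ∃ p : Index, ∃ h : ℝ, 0 < h ∧
      ∃ C : ℝ, ∀ z ∈ K, ∀ j : ℕ, ‖iteratedDeriv j g z‖ / (h ^ j * M.seq p j) ≤ C}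

/-- The class of `M` on the sector of opening `α * π` is holomorphically closed. -/
def HolomorphicallyClosed (M : WeightMatrix) (α : ℝ) : Prop :=
  ∀ f ∈ classMatrix M (sector α), ∀ U : Set ℂ, IsOpen U → closure (f '' sector α) ⊆ U →
    ∀ g : ℂ → ℂ, DifferentiableOn ℂ g U → g ∘ f ∈ classMatrix M (sector α)

/-- The class of `M` on the sector of opening `α * π` is inverse-closed. -/
def InverseClosed (M : WeightMatrix) (α : ℝ) : Prop :=
  ∀ f ∈ classMatrix M (sector α), (∃ c : ℝ, 0 < c ∧ ∀ z ∈ sector α, c ≤ ‖f z‖) →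
    (fun z => 1 / f z) ∈ classMatrix M (sector α)

/-- The class of `M` on the sector of opening `α * π` is closed under composition. -/
def ClosedUnderComposition (M : WeightMatrix) (α : ℝ) : Prop :=
  ∀ f ∈ classMatrix M (sector α), ∀ U : Set ℂ, IsOpen U → closure (f '' sector α) ⊆ U →
    ∀ g ∈ planeClassMatrix M U, g ∘ f ∈ classMatrix M (sector α)

end Ultraholomorphic

/-! Sufficiency of (a) comes from the Faà di Bruno formula, written as a sum over compositions of
`k`: the normalised derivatives of `g ∘ f` are bounded by products `G ℓ * ∏ N (j_i)`, and the `2 ^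
(k - 1)` compositions cost only a geometric factor. Under (rai), with `x = C (check M^(q)_k) ^ (1 /
k)`, each block satisfies `check M^(p)_j ≤ x ^ j` for `j ≤ k`. The exponents add up to `k`, while
Cauchy estimates make the outer derivatives geometric. This gives (b), and (c) is the case `g = 1 /
z`.

The substance is (c) → (a). On the positive ray one builds a member `f` of the class with `(-1) ^ j
f^(j) ≥ 0` which, for each `j`, attains the size of `M^(p)_j` at some point, up to a geometric
factor (`exists_characteristic_function`). For `Λ > sup |f|`, inverse-closedness places `u = 1 / (Λ
- f)` in the class of some `M^(q)`. Up to the sign `(-1) ^ n`, all Taylor coefficients of `u` on the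
ray are nonnegative, so nothing cancels and the coefficient of order `j m` dominates the `m`-th
power of that of `f` of order `j` (`pow_div_le_norm_of_reciprocal`). Taking roots yields (rai)
whenever `j` divides `k`; log-convexity of the regularised sequence fills the gaps, since `j ⌊k /
j⌋` and `k` differ by a factor at most `2`.

The function is `f(z) = ∑ d_k K(μ_k z)` with `K(z) = ∫₀^∞ exp (-z t - t ^ (1 / b)) dt`, `b = α_p -
1` and `μ_k = L_{k+1} / L_k`. Rotating the ray of integration with `arg z` continues `K` to the
whole sector with derivatives of Gevrey size `j ^ (b j)`; this is where `α_p > α` enters.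
Log-convexity lets the weights `d_k` reproduce `L_j` from above and from below.

For the second part, (dc) trades one order of derivative per block, which turns (rai) into (FdB).
(FdB) is exactly what the composition estimate needs for (d), and under the `C^ω` condition (d)
contains (b). -/

namespace Ultraholomorphic

open LogSurface Topology MeasureTheory

/-! ### Iterated derivatives on the Riemann surface of the logarithm -/

namespace LogSurface

/-- The branch of a function on the logarithmic surface around the point with logarithm `w`, as a
function of the planar variable. -/
noncomputable def branch (f : LogSurface → ℂ) (w : ℂ) (ζ : ℂ) : ℂ :=
  f ⟨w + Complex.log (ζ * Complex.exp (-w))⟩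

theorem isOpen_sector (α : ℝ) : IsOpen {w : ℂ | (⟨w⟩ : LogSurface) ∈ sector α} := by
  simp only [sector, arg, Set.mem_ofPred_eq]
  exact isOpen_lt (by fun_prop) (by fun_prop)

theorem HolomorphicOn.zderiv {f : LogSurface → ℂ} {S : Set LogSurface} (hf : HolomorphicOn f S)
    (hS : IsOpen {w : ℂ | (⟨w⟩ : LogSurface) ∈ S}) : HolomorphicOn (zderiv f) S := by
  have h : DifferentiableOn ℂ (deriv (fun w : ℂ => f ⟨w⟩)) {w : ℂ | (⟨w⟩ : LogSurface) ∈ S} :=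
    DifferentiableOn.deriv hf hS
  exact DifferentiableOn.mul (by fun_prop) h

theorem HolomorphicOn.iterate_zderiv {f : LogSurface → ℂ} {S : Set LogSurface}
    (hf : HolomorphicOn f S) (hS : IsOpen {w : ℂ | (⟨w⟩ : LogSurface) ∈ S}) (n : ℕ) :
    HolomorphicOn (LogSurface.zderiv^[n] f) S := by
  induction n with
  | zero => exact hf
  | succ n ih => rw [Function.iterate_succ_apply']; exact ih.zderiv hS

theorem hasDerivAt_branch_log (w ζ : ℂ) (h : ζ * Complex.exp (-w) ∈ Complex.slitPlane) :
    HasDerivAt (fun ζ : ℂ => w + Complex.log (ζ * Complex.exp (-w)))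
      (Complex.exp (-(w + Complex.log (ζ * Complex.exp (-w))))) ζ := by
  have h1 : HasDerivAt (fun ζ : ℂ => ζ * Complex.exp (-w)) (1 * Complex.exp (-w)) ζ :=
    (hasDerivAt_id ζ).mul_const _
  have h2 := (h1.clog h).const_add w
  refine h2.congr_deriv ?_
  have h0 : ζ * Complex.exp (-w) ≠ 0 := Complex.slitPlane_ne_zero h
  rw [neg_add, Complex.exp_add, Complex.exp_neg (Complex.log _), Complex.exp_log h0]
  field_simp

theorem eventually_mem_slitPlane (w : ℂ) :
    ∀ᶠ ζ in 𝓝 (Complex.exp w), ζ * Complex.exp (-w) ∈ Complex.slitPlane := by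
  have hc : ContinuousAt (fun ζ : ℂ => ζ * Complex.exp (-w)) (Complex.exp w) := by fun_prop
  apply hc.eventually_mem
  apply Complex.isOpen_slitPlane.mem_nhds
  simp [← Complex.exp_add]

theorem branch_log_self (w : ℂ) :
    w + Complex.log (Complex.exp w * Complex.exp (-w)) = w := by
  simp [← Complex.exp_add]

theorem eventually_branch_log_mem {S : Set LogSurface}
    (hS : IsOpen {w : ℂ | (⟨w⟩ : LogSurface) ∈ S}) {w : ℂ} (hw : (⟨w⟩ : LogSurface) ∈ S) :
    ∀ᶠ ζ in 𝓝 (Complex.exp w),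
      (⟨w + Complex.log (ζ * Complex.exp (-w))⟩ : LogSurface) ∈ S := by
  have hc := (hasDerivAt_branch_log w _ (eventually_mem_slitPlane w).self_of_nhds).continuousAt
  apply hc.eventually_mem (s := {w : ℂ | (⟨w⟩ : LogSurface) ∈ S})
  apply hS.mem_nhds
  rw [branch_log_self]; exact hw

/-- Since `log' = exp (-log)`, the chain rule turns the planar derivative of a branch into the
branch of `zderiv`. Equality of germs rather than of values at a point allows the induction to
differentiate again. -/
theorem iteratedDeriv_branch_eventuallyEq {f : LogSurface → ℂ} {S : Set LogSurface}
    (hf : HolomorphicOn f S) (hS : IsOpen {w : ℂ | (⟨w⟩ : LogSurface) ∈ S})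
    {w : ℂ} (hw : (⟨w⟩ : LogSurface) ∈ S) (n : ℕ) :
    iteratedDeriv n (branch f w) =ᶠ[𝓝 (Complex.exp w)] branch (LogSurface.zderiv^[n] f) w := by
  induction n with
  | zero => simp
  | succ n ih =>
    rw [iteratedDeriv_succ]
    refine ih.deriv.trans ?_
    filter_upwards [eventually_mem_slitPlane w, eventually_branch_log_mem hS hw] with ζ h1 h2
    have hd : HasDerivAt (fun v : ℂ => (LogSurface.zderiv^[n] f) ⟨v⟩) _ _ :=
      ((hf.iterate_zderiv hS n).differentiableAt (hS.mem_nhds h2)).hasDerivAt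
    have := hd.comp ζ (hasDerivAt_branch_log w ζ h1)
    rw [show branch (LogSurface.zderiv^[n] f) w = (fun v : ℂ => (LogSurface.zderiv^[n] f) ⟨v⟩) ∘
      (fun ζ : ℂ => w + Complex.log (ζ * Complex.exp (-w))) from rfl, this.deriv]
    rw [branch, Function.iterate_succ_apply', LogSurface.zderiv, mul_comm]

theorem iteratedDeriv_branch {f : LogSurface → ℂ} {S : Set LogSurface}
    (hf : HolomorphicOn f S) (hS : IsOpen {w : ℂ | (⟨w⟩ : LogSurface) ∈ S})
    {w : ℂ} (hw : (⟨w⟩ : LogSurface) ∈ S) (n : ℕ) :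
    iteratedDeriv n (branch f w) (Complex.exp w) = (LogSurface.zderiv^[n] f) ⟨w⟩ := by
  rw [(iteratedDeriv_branch_eventuallyEq hf hS hw n).self_of_nhds, branch, branch_log_self]

theorem analyticAt_branch {f : LogSurface → ℂ} {S : Set LogSurface}
    (hf : HolomorphicOn f S) (hS : IsOpen {w : ℂ | (⟨w⟩ : LogSurface) ∈ S})
    {w : ℂ} (hw : (⟨w⟩ : LogSurface) ∈ S) : AnalyticAt ℂ (branch f w) (Complex.exp w) := by
  rw [Complex.analyticAt_iff_eventually_differentiableAt]
  filter_upwards [eventually_mem_slitPlane w, eventually_branch_log_mem hS hw] with ζ h1 h2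
  have hd : HasDerivAt (fun v : ℂ => f ⟨v⟩) _ _ :=
      (hf.differentiableAt (hS.mem_nhds h2)).hasDerivAt
  exact (hd.comp ζ (hasDerivAt_branch_log w ζ h1)).differentiableAt

end LogSurface

/-! ### Derivatives of compositions and Cauchy estimates -/

/-- Faà di Bruno in norm: the Taylor series of `g ∘ F` is the composition of the two Taylor series,
by uniqueness of power series, and each composition of `k` contributes at most the product of the
norms. -/
theorem norm_iteratedDeriv_comp_le {g F : ℂ → ℂ} {x : ℂ} (hg : AnalyticAt ℂ g (F x))
    (hF : AnalyticAt ℂ F x) (k : ℕ) :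
    ‖iteratedDeriv k (g ∘ F) x‖ / k.factorial ≤
      ∑ c : Composition k, ‖iteratedDeriv c.length g (F x)‖ / c.length.factorial *
        ∏ i : Fin c.length, ‖iteratedDeriv (c.blocksFun i) F x‖ / (c.blocksFun i).factorial := by
  have h1 := hg.hasFPowerSeriesAt.comp hF.hasFPowerSeriesAt
  have h2 := (hg.comp hF).hasFPowerSeriesAt
  have h3 := h2.eq_formalMultilinearSeries h1
  have h4 : ‖iteratedDeriv k (g ∘ F) x‖ / k.factorial =
      ‖FormalMultilinearSeries.ofScalars ℂ
        (fun n ↦ iteratedDeriv n (g ∘ F) x / n.factorial) k‖ := by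
    rw [FormalMultilinearSeries.ofScalars_norm, norm_div, Complex.norm_natCast]
  rw [h4, h3, FormalMultilinearSeries.comp]
  refine (norm_sum_le _ _).trans (Finset.sum_le_sum fun c _ => ?_)
  refine (FormalMultilinearSeries.compAlongComposition_norm _ _ c).trans (le_of_eq ?_)
  simp only [FormalMultilinearSeries.ofScalars_norm, norm_div, Complex.norm_natCast]

theorem norm_iterate_zderiv_comp_le {f : LogSurface → ℂ} {S : Set LogSurface}
    (hf : HolomorphicOn f S) (hS : IsOpen {w : ℂ | (⟨w⟩ : LogSurface) ∈ S}) {g : ℂ → ℂ}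
    {U : Set ℂ} (hU : IsOpen U) (hg : DifferentiableOn ℂ g U) (hfU : Set.MapsTo f S U)
    {z : LogSurface} (hz : z ∈ S) (k : ℕ) :
    ‖(zderiv^[k] (g ∘ f)) z‖ / k.factorial ≤
      ∑ c : Composition k, ‖iteratedDeriv c.length g (f z)‖ / c.length.factorial *
        ∏ i : Fin c.length, ‖(zderiv^[c.blocksFun i] f) z‖ / (c.blocksFun i).factorial := by
  obtain ⟨w⟩ := z
  have hgf : HolomorphicOn (g ∘ f) S :=
    hg.comp (t := U) (f := fun w : ℂ => f ⟨w⟩) hf (fun w hw => hfU hw)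
  have hx : branch f w (Complex.exp w) = f ⟨w⟩ := by rw [branch, branch_log_self]
  have hga : AnalyticAt ℂ g (branch f w (Complex.exp w)) := by
    rw [hx]; exact hg.analyticAt (hU.mem_nhds (hfU hz))
  have := norm_iteratedDeriv_comp_le hga (analyticAt_branch hf hS hz) k
  have hb : g ∘ branch f w = branch (g ∘ f) w := rfl
  simpa only [hb, iteratedDeriv_branch hgf hS hz, iteratedDeriv_branch hf hS hz, hx] using this

theorem exists_norm_iteratedDeriv_le_of_isCompact {g : ℂ → ℂ} {U K : Set ℂ} (hU : IsOpen U)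
    (hg : DifferentiableOn ℂ g U) (hK : IsCompact K) (hKU : K ⊆ U) :
    ∃ C ρ : ℝ, 0 < C ∧ 0 < ρ ∧
      ∀ z ∈ K, ∀ n : ℕ, ‖iteratedDeriv n g z‖ ≤ C * ρ ^ n * n.factorial := by
  obtain ⟨δ, hδ, hδU⟩ := hK.exists_cthickening_subset_open hU hKU
  obtain ⟨C, hC⟩ := (hK.cthickening (r := δ)).exists_bound_of_continuousOn
    (hg.continuousOn.mono hδU)
  refine ⟨max C 1, δ⁻¹, by positivity, by positivity, fun z hz n => ?_⟩
  have hb : Metric.closedBall z δ ⊆ Metric.cthickening δ K :=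
    Metric.closedBall_subset_cthickening hz δ
  have := Complex.norm_iteratedDeriv_le_of_forall_mem_sphere_norm_le (C := max C 1) n hδ
    ((hg.mono (hb.trans hδU)).diffContOnCl_ball subset_rfl)
    (fun y hy => (hC y (hb (Metric.sphere_subset_closedBall hy))).trans (le_max_left _ _))
  refine this.trans (le_of_eq ?_)
  rw [inv_pow]; field_simp

/-! ### Elementary facts on weight matrices -/

theorem check_pos {M : ℕ → ℝ} (hM : ∀ j, 0 < M j) (j : ℕ) : 0 < check M j :=
  div_pos (hM j) (by positivity)

theorem WeightMatrix.check_zero (M : WeightMatrix) (p : Index) : check (M.seq p) 0 = 1 := by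
  simp [check, M.zero]

theorem WeightMatrix.check_mono (M : WeightMatrix) {p q : Index} (h : p ≤ q) (j : ℕ) :
    check (M.seq p) j ≤ check (M.seq q) j :=
  div_le_div_of_nonneg_right (M.mono p q h j) (by positivity)

theorem check_mul_factorial (M : ℕ → ℝ) (j : ℕ) : check M j * j.factorial = M j := by
  rw [check]; field_simp

theorem mem_classMatrix_iff {M : WeightMatrix} {S : Set LogSurface} {f : LogSurface → ℂ} :
    f ∈ classMatrix M S ↔ HolomorphicOn f S ∧ ∃ p : Index, ∃ A h : ℝ, 0 < A ∧ 0 < h ∧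
      ∀ z ∈ S, ∀ j : ℕ, ‖(zderiv^[j] f) z‖ ≤ A * h ^ j * M.seq p j := by
  constructor
  · rintro ⟨p, h, hh, hf, C, hC⟩
    refine ⟨hf, p, max C 1, h, by positivity, hh, fun z hz j => ?_⟩
    have h1 : 0 < h ^ j * M.seq p j := mul_pos (by positivity) (M.pos p j)
    have := (hC z hz j).trans (le_max_left C 1)
    rw [div_le_iff₀ h1] at this
    linarith
  · rintro ⟨hf, p, A, h, hA, hh, H⟩
    refine ⟨p, h, hh, hf, A, fun z hz j => ?_⟩
    have h1 : 0 < h ^ j * M.seq p j := mul_pos (by positivity) (M.pos p j)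
    rw [div_le_iff₀ h1]
    linarith [H z hz j]

theorem mem_planeClassMatrix_iff {M : WeightMatrix} {U : Set ℂ} {g : ℂ → ℂ} :
    g ∈ planeClassMatrix M U ↔ DifferentiableOn ℂ g U ∧ ∀ K : Set ℂ, IsCompact K → K ⊆ U →
      ∃ p : Index, ∃ A h : ℝ, 0 < A ∧ 0 < h ∧
        ∀ z ∈ K, ∀ j : ℕ, ‖iteratedDeriv j g z‖ ≤ A * h ^ j * M.seq p j := by
  refine and_congr_right fun _ => forall_congr' fun K => forall_congr' fun _ =>
    forall_congr' fun _ => exists_congr fun p => ?_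
  constructor
  · rintro ⟨h, hh, C, hC⟩
    refine ⟨max C 1, h, by positivity, hh, fun z hz j => ?_⟩
    have h1 : 0 < h ^ j * M.seq p j := mul_pos (by positivity) (M.pos p j)
    have := (hC z hz j).trans (le_max_left C 1)
    rw [div_le_iff₀ h1] at this
    linarith
  · rintro ⟨A, h, hA, hh, H⟩
    refine ⟨h, hh, A, fun z hz j => ?_⟩
    have h1 : 0 < h ^ j * M.seq p j := mul_pos (by positivity) (M.pos p j)
    rw [div_le_iff₀ h1]
    linarith [H z hz j]

theorem isCompact_closure_image {M : WeightMatrix} {S : Set LogSurface} {f : LogSurface → ℂ}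
    (hf : f ∈ classMatrix M S) : IsCompact (closure (f '' S)) := by
  obtain ⟨-, p, A, h, -, -, H⟩ := mem_classMatrix_iff.1 hf
  refine Bornology.IsBounded.isCompact_closure ?_
  refine (Metric.isBounded_closedBall (x := (0 : ℂ)) (r := A * h ^ 0 * M.seq p 0)).subset ?_
  rintro _ ⟨z, hz, rfl⟩
  simpa using H z hz 0

/-! ### Composition estimates -/

theorem sum_composition_le {G N R : ℕ → ℝ} (hN : ∀ j, 0 ≤ N j) {A h C r : ℝ}
    (hA : 0 < A) (hh : 0 < h) (hC : 0 < C) (hr : 0 < r) (hG : ∀ j, 0 ≤ G j) (k : ℕ)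
    (hR : ∀ c : Composition k, G c.length * ∏ i, N (c.blocksFun i) ≤ R k) :
    ∑ c : Composition k, C * r ^ c.length * G c.length *
        ∏ i : Fin c.length, (A * h ^ c.blocksFun i * N (c.blocksFun i)) ≤
      C * (2 * max (r * A) 1 * h) ^ k * R k := by
  have hR0 : 0 ≤ R k := (mul_nonneg (hG _) (Finset.prod_nonneg fun _ _ => hN _)).trans
    (hR (Composition.ones k))
  have key : ∀ c : Composition k, C * r ^ c.length * G c.length *
        ∏ i : Fin c.length, (A * h ^ c.blocksFun i * N (c.blocksFun i)) ≤
      C * max (r * A) 1 ^ k * h ^ k * R k := by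
    intro c
    rw [Finset.prod_mul_distrib, Finset.prod_mul_distrib, Finset.prod_pow_eq_pow_sum,
      Composition.sum_blocksFun, Finset.prod_const, Finset.card_univ, Fintype.card_fin]
    have e : C * r ^ c.length * G c.length * (A ^ c.length * h ^ k * ∏ i, N (c.blocksFun i)) =
        C * (r * A) ^ c.length * h ^ k * (G c.length * ∏ i, N (c.blocksFun i)) := by
      rw [mul_pow]; ring
    rw [e]
    have h1 : (r * A) ^ c.length ≤ max (r * A) 1 ^ k :=
      (pow_le_pow_left₀ (by positivity) (le_max_left _ _) _).trans
        (pow_le_pow_right₀ (le_max_right _ _) c.length_le)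
    have := hR c
    gcongr
    exact mul_nonneg (hG _) (Finset.prod_nonneg fun _ _ => hN _)
  refine (Finset.sum_le_card_nsmul _ _ _ fun c _ => key c).trans ?_
  rw [Finset.card_univ, composition_card, nsmul_eq_mul, mul_pow, mul_pow]
  have h2 : ((2 ^ (k - 1) : ℕ) : ℝ) ≤ 2 ^ k := by
    push_cast
    exact pow_le_pow_right₀ one_le_two (Nat.sub_le _ _)
  calc ((2 ^ (k - 1) : ℕ) : ℝ) * (C * max (r * A) 1 ^ k * h ^ k * R k)
      ≤ 2 ^ k * (C * max (r * A) 1 ^ k * h ^ k * R k) := by gcongr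
    _ = _ := by ring

/-- The common core of both closure results. `G` measures the outer function: it is `1` for
holomorphic `g` under (rai), and `check M` for `g` in the plane class under (FdB). -/
theorem comp_mem_classMatrix {M : WeightMatrix} {f : LogSurface → ℂ} {S : Set LogSurface}
    (hf : HolomorphicOn f S) (hS : IsOpen {w : ℂ | (⟨w⟩ : LogSurface) ∈ S}) {g : ℂ → ℂ}
    {U : Set ℂ} (hU : IsOpen U) (hg : DifferentiableOn ℂ g U) (hfU : Set.MapsTo f S U)
    {G N : ℕ → ℝ} (hN : ∀ j, 0 ≤ N j) {A h C r a b : ℝ} {q : Index}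
    (hA : 0 < A) (hh : 0 < h) (hC : 0 < C) (hr : 0 < r) (ha : 0 < a) (hb : 0 < b)
    (hG : ∀ j, 0 ≤ G j)
    (hfb : ∀ z ∈ S, ∀ j, ‖(zderiv^[j] f) z‖ / j.factorial ≤ A * h ^ j * N j)
    (hgb : ∀ z ∈ S, ∀ j, ‖iteratedDeriv j g (f z)‖ / j.factorial ≤ C * r ^ j * G j)
    (hR : ∀ k, ∀ c : Composition k,
      G c.length * ∏ i, N (c.blocksFun i) ≤ a * b ^ k * check (M.seq q) k) :
    g ∘ f ∈ classMatrix M S := by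
  refine mem_classMatrix_iff.2 ⟨hg.comp (t := U) (f := fun w : ℂ => f ⟨w⟩) hf fun w hw => hfU hw,
    q, C * a, 2 * max (r * A) 1 * h * b, by positivity, by positivity, fun z hz k => ?_⟩
  have h1 := norm_iterate_zderiv_comp_le hf hS hU hg hfU hz k
  have h2 : ‖(zderiv^[k] (g ∘ f)) z‖ / k.factorial ≤
      C * (2 * max (r * A) 1 * h) ^ k * (a * b ^ k * check (M.seq q) k) := by
    refine (h1.trans (Finset.sum_le_sum fun c _ => ?_)).trans
      (sum_composition_le (R := fun k => a * b ^ k * check (M.seq q) k) hN hA hh hC hr hG k (hR k))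
    refine mul_le_mul (hgb z hz _) ?_ (Finset.prod_nonneg fun _ _ => by positivity)
      (mul_nonneg (by positivity) (hG _))
    exact Finset.prod_le_prod (fun _ _ => by positivity) fun i _ => hfb z hz _
  rw [div_le_iff₀ (by positivity)] at h2
  refine h2.trans (le_of_eq ?_)
  rw [← check_mul_factorial (M.seq q) k, mul_pow _ b]
  ring

/-- The base of the power depends on `k` alone, so bounds for several blocks multiply by adding
exponents. The case `j = 0` is included because `check M 0 = 1`. -/
theorem WeightMatrix.HasRai.exists_le_pow {M : WeightMatrix} (hM : M.HasRai) (p : Index) :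
    ∃ C : ℝ, 0 < C ∧ ∃ q : Index, ∀ j k : ℕ, j ≤ k →
      check (M.seq p) j ≤ (C * check (M.seq q) k ^ (1 / (k : ℝ))) ^ j := by
  obtain ⟨C, hC, q, H⟩ := hM p
  refine ⟨C, hC, q, fun j k hjk => ?_⟩
  rcases Nat.eq_zero_or_pos j with rfl | hj
  · simp [M.check_zero]
  · have h0 := (check_pos (M.pos p) j).le
    calc check (M.seq p) j = (check (M.seq p) j ^ (1 / (j : ℝ))) ^ j := by
          rw [one_div, Real.rpow_inv_natCast_pow h0 hj.ne']
      _ ≤ _ := pow_le_pow_left₀ (Real.rpow_nonneg h0 _) (H j k hj hjk) j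

theorem WeightMatrix.mul_rpow_pow (M : WeightMatrix) (q : Index) (C : ℝ) (k : ℕ) :
    (C * check (M.seq q) k ^ (1 / (k : ℝ))) ^ k = C ^ k * check (M.seq q) k := by
  rcases Nat.eq_zero_or_pos k with rfl | hk
  · simp [M.check_zero]
  · rw [mul_pow, one_div, Real.rpow_inv_natCast_pow (check_pos (M.pos q) k).le hk.ne']

/-! ### Stability properties from conditions on the weight matrix -/

theorem HolomorphicallyClosed.of_hasRai {M : WeightMatrix} (hM : M.HasRai) (α : ℝ) :
    HolomorphicallyClosed M α := by
  intro f hf U hU hfU g hg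
  have hK := isCompact_closure_image hf
  obtain ⟨C, ρ, hC, hρ, hgb⟩ := exists_norm_iteratedDeriv_le_of_isCompact hU hg hK hfU
  obtain ⟨hfh, p, A, h, hA, hh, hfb⟩ := mem_classMatrix_iff.1 hf
  obtain ⟨D, hD, q, hq⟩ := hM.exists_le_pow p
  refine comp_mem_classMatrix (G := fun _ => 1) (N := check (M.seq p)) (a := 1) (b := D) (q := q)
    hfh (isOpen_sector α) hU hg (fun z hz => hfU (subset_closure ⟨z, hz, rfl⟩))
    (fun j => (check_pos (M.pos p) j).le) hA hh hC hρ one_pos hD (fun _ => zero_le_one)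
    (fun z hz j => ?_) (fun z hz j => ?_) (fun k c => ?_)
  · rw [check, ← mul_div_assoc]
    gcongr
    exact hfb z hz j
  · rw [div_le_iff₀ (by positivity), mul_one]
    exact hgb _ (subset_closure ⟨z, hz, rfl⟩) j
  · rw [one_mul, one_mul, ← M.mul_rpow_pow]
    conv_rhs => rw [← c.sum_blocksFun, ← Finset.prod_pow_eq_pow_sum]
    refine Finset.prod_le_prod (fun i _ => (check_pos (M.pos p) _).le) fun i _ => ?_
    rw [c.sum_blocksFun]
    exact hq _ _ (c.blocksFun_le i)

theorem InverseClosed.of_holomorphicallyClosed {M : WeightMatrix} {α : ℝ}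
    (hM : HolomorphicallyClosed M α) : InverseClosed M α := by
  rintro f hf ⟨c, hc, hcf⟩
  have := hM f hf {0}ᶜ isOpen_compl_singleton ?_ (fun z => 1 / z) ?_
  · exact this
  · have h1 : closure (f '' sector α) ⊆ {z : ℂ | c ≤ ‖z‖} := by
      refine closure_minimal ?_ (isClosed_le continuous_const continuous_norm)
      rintro _ ⟨z, hz, rfl⟩
      exact hcf z hz
    intro z hz h0
    have : c ≤ ‖z‖ := h1 hz
    rw [Set.mem_singleton_iff.1 h0, norm_zero] at this
    linarith
  · intro z hz
    have h0 : z ≠ 0 := hz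
    simpa only [one_div] using (differentiableAt_inv h0).differentiableWithinAt

/-- The factor `check M_ℓ` costs `x ^ ℓ` beyond the `x ^ k` available. Derivation closedness lowers
each of the `ℓ` blocks by one order, and `ℓ + ∑ (j_i - 1) = k` restores the balance. -/
theorem WeightMatrix.HasRai.hasFdB {M : WeightMatrix} (hM : M.HasRai) (hdc : M.HasDc) :
    M.HasFdB := by
  intro p
  obtain ⟨C₁, hC₁, q₁, h₁⟩ := hdc p
  obtain ⟨C, hC, q, hq⟩ := hM.exists_le_pow (max p q₁)
  refine ⟨q, 1, C₁ * C, one_pos, by positivity, fun k => ?_⟩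
  rcases Nat.eq_zero_or_pos k with rfl | hk
  · simp [circ, M.check_zero]
  rw [circ, if_neg hk.ne']
  refine Finset.sup'_le _ _ fun c _ => ?_
  set x := C * check (M.seq q) k ^ (1 / (k : ℝ)) with hx
  have hx0 : 0 < x := mul_pos hC (Real.rpow_pos_of_pos (check_pos (M.pos q) k) _)
  have hl : check (M.seq p) c.length ≤ x ^ c.length :=
    (M.check_mono (le_max_left _ _) _).trans (hq _ _ c.length_le)
  have hb : ∀ i, check (M.seq p) (c.blocksFun i) ≤ C₁ ^ c.blocksFun i * x ^ (c.blocksFun i - 1) := by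
    intro i
    obtain ⟨j, hj⟩ : ∃ j, c.blocksFun i = j + 1 :=
      Nat.exists_eq_add_of_le' (c.one_le_blocksFun i)
    have hjk : j ≤ k := by have := c.blocksFun_le i; omega
    rw [hj, Nat.add_sub_cancel]
    calc check (M.seq p) (j + 1) ≤ C₁ ^ (j + 1) * M.seq q₁ j / (j + 1).factorial := by
          rw [check]; gcongr; exact h₁ j
      _ ≤ C₁ ^ (j + 1) * M.seq q₁ j / j.factorial := by
          have := M.pos q₁ j
          have := Nat.factorial_le (Nat.le_succ j)
          gcongr
      _ = C₁ ^ (j + 1) * check (M.seq q₁) j := by rw [check, mul_div_assoc]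
      _ ≤ C₁ ^ (j + 1) * x ^ j := by
          gcongr
          exact (M.check_mono (le_max_right _ _) _).trans (hq _ _ hjk)
  have hsum : c.length + ∑ i, (c.blocksFun i - 1) = k := by
    have : ∑ i, (c.blocksFun i - 1 + 1) = k := by
      exact (Finset.sum_congr rfl fun i _ => Nat.sub_add_cancel (c.one_le_blocksFun i)).trans
        c.sum_blocksFun
    rw [Finset.sum_add_distrib] at this
    simp at this
    omega
  calc check (M.seq p) c.length * ∏ i, check (M.seq p) (c.blocksFun i)
      ≤ x ^ c.length * ∏ i, (C₁ ^ c.blocksFun i * x ^ (c.blocksFun i - 1)) := by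
        refine mul_le_mul hl (Finset.prod_le_prod (fun i _ => (check_pos (M.pos p) _).le)
          fun i _ => hb i) (Finset.prod_nonneg fun i _ => (check_pos (M.pos p) _).le) (by positivity)
    _ = C₁ ^ k * x ^ k := by
        rw [Finset.prod_mul_distrib, Finset.prod_pow_eq_pow_sum, c.sum_blocksFun,
          Finset.prod_pow_eq_pow_sum, mul_left_comm, ← pow_add, hsum]
    _ = 1 * (C₁ * C) ^ k * check (M.seq q) k := by
        rw [hx, M.mul_rpow_pow, one_mul, mul_pow, mul_assoc]

theorem ClosedUnderComposition.of_hasFdB {M : WeightMatrix} (hM : M.HasFdB) (α : ℝ) :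
    ClosedUnderComposition M α := by
  intro f hf U hU hfU g hg
  have hK := isCompact_closure_image hf
  obtain ⟨hgd, hgb⟩ := mem_planeClassMatrix_iff.1 hg
  obtain ⟨p₁, C, r, hC, hr, hgb⟩ := hgb _ hK hfU
  obtain ⟨hfh, p₂, A, h, hA, hh, hfb⟩ := mem_classMatrix_iff.1 hf
  obtain ⟨q, a, b, ha, hb, hq⟩ := hM (max p₁ p₂)
  have hpos := check_pos (M.pos (max p₁ p₂))
  refine comp_mem_classMatrix (G := check (M.seq (max p₁ p₂))) (N := check (M.seq (max p₁ p₂)))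
    (q := q) hfh (isOpen_sector α) hU hgd (fun z hz => hfU (subset_closure ⟨z, hz, rfl⟩))
    (fun j => (hpos j).le) hA hh hC hr ha hb (fun j => (hpos j).le)
    (fun z hz j => ?_) (fun z hz j => ?_) (fun k c => ?_)
  · rw [check, ← mul_div_assoc]
    gcongr
    refine (hfb z hz j).trans ?_
    gcongr
    exact M.mono _ _ (le_max_right _ _) j
  · rw [check, ← mul_div_assoc]
    gcongr
    refine (hgb _ (subset_closure ⟨z, hz, rfl⟩) j).trans ?_
    gcongr
    exact M.mono _ _ (le_max_left _ _) j
  · refine le_trans ?_ (hq k)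
    rcases Nat.eq_zero_or_pos k with rfl | hk
    · have h0 : c.length = 0 := Nat.le_zero.1 c.length_le
      have : IsEmpty (Fin c.length) := by rw [h0]; infer_instance
      simp [circ, h0, M.check_zero]
    · rw [circ, if_neg hk.ne']
      exact Finset.le_sup' (fun c : Composition k => check (M.seq (max p₁ p₂)) c.length *
        ∏ i : Fin c.length, check (M.seq (max p₁ p₂)) (c.blocksFun i)) (Finset.mem_univ c)

theorem WeightMatrix.HasComega.exists_pow_le {M : WeightMatrix} (hM : M.HasComega) :
    ∃ p : Index, ∃ c ε : ℝ, 0 < c ∧ 0 < ε ∧ ∀ j, c * ε ^ j ≤ check (M.seq p) j := by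
  obtain ⟨p, hp⟩ := hM
  obtain ⟨ε, hε0, hε⟩ := ENNReal.lt_iff_exists_nnreal_btwn.1 hp
  have hε0 : (0 : ℝ) < ε := by exact_mod_cast hε0
  have hpos := check_pos (M.pos p)
  obtain ⟨n, hn⟩ := eventually_atTop.1 (eventually_lt_of_lt_liminf hε)
  have hlarge : ∀ j, n + 1 ≤ j → (ε : ℝ) ^ j ≤ check (M.seq p) j := by
    intro j hj
    have h1 := hn j (by omega)
    rw [ENNReal.lt_ofReal_iff_toReal_lt (by simp), ENNReal.coe_toReal] at h1
    calc (ε : ℝ) ^ j ≤ (check (M.seq p) j ^ (1 / (j : ℝ))) ^ j := by gcongr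
      _ = check (M.seq p) j := by
        rw [one_div, Real.rpow_inv_natCast_pow (hpos j).le (by omega)]
  -- The lower limit controls only large `j`; the finitely many remaining indices are absorbed into
  -- the constant.
  obtain ⟨i, -, hi⟩ := (Finset.range (n + 1)).exists_min_image
    (fun j => check (M.seq p) j / (ε : ℝ) ^ j) ⟨0, by simp⟩
  refine ⟨p, min 1 (check (M.seq p) i / (ε : ℝ) ^ i), ε, ?_, hε0, fun j => ?_⟩
  · exact lt_min one_pos (div_pos (hpos i) (by positivity))
  · rcases lt_or_ge j (n + 1) with hj | hj
    · rw [← le_div_iff₀ (by positivity)]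
      exact (min_le_right _ _).trans (hi j (by simpa using hj))
    · refine le_trans ?_ (hlarge j hj)
      exact mul_le_of_le_one_left (by positivity) (min_le_left _ _)

/-- The lower bound `c ε ^ j j! ≤ M_j` and Cauchy estimates place every holomorphic function on `U`
in the plane class. -/
theorem HolomorphicallyClosed.of_closedUnderComposition {M : WeightMatrix} {α : ℝ}
    (hM : ClosedUnderComposition M α) (hω : M.HasComega) : HolomorphicallyClosed M α := by
  obtain ⟨p, c, ε, hc, hε, hcε⟩ := hω.exists_pow_le
  intro f hf U hU hfU g hg
  refine hM f hf U hU hfU g (mem_planeClassMatrix_iff.2 ⟨hg, fun K hK hKU => ?_⟩)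
  obtain ⟨C, ρ, hC, hρ, hgb⟩ := exists_norm_iteratedDeriv_le_of_isCompact hU hg hK hKU
  refine ⟨p, C / c, ρ / ε, by positivity, by positivity, fun z hz j => (hgb z hz j).trans ?_⟩
  calc C * ρ ^ j * j.factorial = C / c * (ρ / ε) ^ j * (c * ε ^ j) * j.factorial := by
        rw [div_pow]; field_simp
    _ ≤ C / c * (ρ / ε) ^ j * check (M.seq p) j * j.factorial := by gcongr; exact hcε j
    _ = C / c * (ρ / ε) ^ j * M.seq p j := by rw [mul_assoc _ (check _ _), check_mul_factorial]

/-! ### A Laplace-type kernel on sectors -/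

theorem gevreyBar_eq_exp (b : ℝ) (j : ℕ) : gevreyBar b j = Real.exp (j * b * Real.log j) := by
  rcases Nat.eq_zero_or_pos j with rfl | hj
  · simp [gevreyBar]
  · rw [gevreyBar, Real.rpow_def_of_pos (by exact_mod_cast hj), mul_comm]

/-- This is `log y ≤ y - 1` at `y = c exp (ρ / b) / (A b)`, where `y = 1` locates the maximum. With
`t = exp ρ` it bounds `t ^ A exp (-c t ^ (1 / b))`, the source of the Gevrey growth. -/
theorem mul_sub_exp_div_le {A b c : ℝ} (hA : 0 < A) (hb : 0 < b) (hc : 0 < c) (ρ : ℝ) :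
    A * ρ - c * Real.exp (ρ / b) ≤ A * b * Real.log (A * b / c) := by
  have h1 := Real.log_le_sub_one_of_pos (x := c * Real.exp (ρ / b) / (A * b)) (by positivity)
  rw [Real.log_div (by positivity) (by positivity), Real.log_mul hc.ne' (by positivity),
    Real.log_exp] at h1
  rw [Real.log_div (by positivity) hc.ne']
  have h2 := mul_le_mul_of_nonneg_left h1 (show 0 ≤ A * b by positivity)
  have e1 : A * b * (c * Real.exp (ρ / b) / (A * b) - 1) = c * Real.exp (ρ / b) - A * b := by
    field_simp
  have e2 : A * b * (Real.log c + ρ / b - Real.log (A * b)) =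
      A * b * (Real.log c - Real.log (A * b)) + A * ρ := by field_simp; ring
  rw [e1, e2] at h2
  have : 0 < A * b := by positivity
  nlinarith

theorem exp_nat_mul_sub_exp_div_le {b c : ℝ} (hb : 0 < b) (hc : 0 < c) (j : ℕ) (ρ : ℝ) :
    Real.exp (j * ρ - c * Real.exp (ρ / b)) ≤
      Real.exp (b * Real.log (b / c)) ^ j * gevreyBar b j := by
  rw [gevreyBar_eq_exp, ← Real.exp_nat_mul, ← Real.exp_add, Real.exp_le_exp]
  rcases Nat.eq_zero_or_pos j with rfl | hj
  · simp; positivity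
  · have hj' : (0 : ℝ) < j := by exact_mod_cast hj
    refine (mul_sub_exp_div_le hj' hb hc ρ).trans (le_of_eq ?_)
    rw [mul_div_assoc, Real.log_mul hj'.ne' (by positivity)]
    ring

theorem exists_exp_mul_sub_exp_div_le {A b c : ℝ} (hA : 1 ≤ A) (hb : 0 < b) (hc : 0 < c) :
    ∃ K : ℝ, 0 < K ∧ ∀ ρ : ℝ, Real.exp (A * ρ - c * Real.exp (ρ / b)) ≤ K * Real.exp (-|ρ|) := by
  refine ⟨max 1 (Real.exp ((A + 1) * b * Real.log ((A + 1) * b / c))), by positivity,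
    fun ρ => ?_⟩
  have hp : 0 < Real.exp (-|ρ|) := Real.exp_pos _
  rcases le_total ρ 0 with h | h
  · refine le_trans ?_ (mul_le_mul_of_nonneg_right (le_max_left _ _) hp.le)
    rw [one_mul, Real.exp_le_exp, abs_of_nonpos h, neg_neg]
    have : 0 < c * Real.exp (ρ / b) := by positivity
    nlinarith
  · refine le_trans ?_ (mul_le_mul_of_nonneg_right (le_max_right _ _) hp.le)
    rw [← Real.exp_add, Real.exp_le_exp, abs_of_nonneg h]
    have := mul_sub_exp_div_le (show 0 < A + 1 by linarith) hb hc ρ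
    linarith

theorem integrable_exp_neg_abs_sub (a : ℝ) : Integrable fun u : ℝ => Real.exp (-|u - a|) := by
  suffices h : Integrable fun u : ℝ => Real.exp (-|u|) from h.comp_sub_right a
  have h1 : IntegrableOn (fun u : ℝ => Real.exp (-|u|)) (Set.Iic 0) :=
    (integrableOn_exp_Iic 0).congr_fun (fun u hu => by
      simp [abs_of_nonpos (show u ≤ 0 from hu)]) measurableSet_Iic
  have h2 : IntegrableOn (fun u : ℝ => Real.exp (-|u|)) (Set.Ioi 0) :=
    (integrableOn_exp_neg_Ioi 0).congr_fun (fun u hu => by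
      simp [abs_of_pos (show 0 < u from hu)]) measurableSet_Ioi
  have := h1.union h2
  rwa [Set.Iic_union_Ioi, integrableOn_univ] at this

theorem integrable_of_norm_le_exp_neg_abs {F : ℝ → ℂ} (hF : Continuous F) {K a : ℝ}
    (h : ∀ u, ‖F u‖ ≤ K * Real.exp (-|u - a|)) : Integrable F :=
  ((integrable_exp_neg_abs_sub a).const_mul K).mono' hF.aestronglyMeasurable
    (Eventually.of_forall h)

theorem integrable_exp_mul_sub_exp_div {A b c : ℝ} (hA : 1 ≤ A) (hb : 0 < b) (hc : 0 < c) :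
    Integrable fun u : ℝ => Real.exp (A * u - c * Real.exp (u / b)) := by
  obtain ⟨K, -, hK⟩ := exists_exp_mul_sub_exp_div_le hA hb hc
  refine ((integrable_exp_neg_abs_sub 0).const_mul K).mono' (by fun_prop)
    (Eventually.of_forall fun u => ?_)
  simpa [Real.norm_eq_abs] using hK u

/-- The integrand of the kernel. -/
noncomputable def kernelIntegrand (b κ : ℝ) (j : ℕ) (w : ℂ) (u : ℝ) : ℂ :=
  Complex.exp ((j + 1) * (u - κ * w) - Complex.exp (w + (u - κ * w)) -
    Complex.exp ((u - κ * w) / b))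

/-- For `κ = 0` this is `∫₀^∞ t ^ j * exp (-z t - t ^ (1 / b)) dt` with `z = exp w` and `t = exp u`.
The parameter `κ` rotates the ray of integration along with the argument of `z`. -/
noncomputable def kernel (b κ : ℝ) (j : ℕ) (w : ℂ) : ℂ := ∫ u : ℝ, kernelIntegrand b κ j w u

/-- The kernel on the real axis. -/
noncomputable def realKernel (b : ℝ) (j : ℕ) (x : ℝ) : ℝ :=
  ∫ u : ℝ, Real.exp ((j + 1) * u - Real.exp (x + u) - Real.exp (u / b))

theorem continuous_kernelIntegrand (b κ : ℝ) (j : ℕ) (w : ℂ) :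
    Continuous (kernelIntegrand b κ j w) := by
  unfold kernelIntegrand
  fun_prop

theorem cos_le_cos_of_abs_le {x y : ℝ} (h : |x| ≤ y) (hy : y ≤ Real.pi) :
    Real.cos y ≤ Real.cos x := by
  rw [← Real.cos_abs x]
  exact Real.cos_le_cos_of_nonneg_of_le_pi (abs_nonneg x) hy h

/-- On the rotated ray `t = exp (u - κ w)` the product `z t` has argument `(1 - κ) arg z`, at most
`π / 2` in modulus, so `exp (-z t)` is bounded by `1`. The argument of `t ^ (1 / b)` is `-κ arg z /
b`, whose cosine controls the decay. -/
theorem norm_kernelIntegrand_le {b κ α : ℝ} (hb : 0 < b) (hκ : 0 ≤ κ) (hκ1 : κ ≤ 1)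
    (hα : (1 - κ) * α ≤ 1) (hαb : κ * α ≤ b) (j : ℕ) {w : ℂ} (hw : |w.im| < α * Real.pi / 2)
    (u : ℝ) :
    ‖kernelIntegrand b κ j w u‖ ≤ Real.exp ((j + 1) * (u - κ * w.re) -
      Real.cos (κ * α * Real.pi / 2 / b) * Real.exp ((u - κ * w.re) / b)) := by
  have hπ := Real.pi_pos
  rw [kernelIntegrand, Complex.norm_exp, Real.exp_le_exp]
  have hv : ((u : ℂ) - κ * w).re = u - κ * w.re := by simp
  have hvi : ((u : ℂ) - κ * w).im = -(κ * w.im) := by simp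
  have e1 : (((j : ℂ) + 1) * (u - κ * w)).re = (j + 1) * (u - κ * w.re) := by
    simp
  have e2 : (Complex.exp ((u - κ * w) / b)).re =
      Real.exp ((u - κ * w.re) / b) * Real.cos (-(κ * w.im) / b) := by
    rw [Complex.exp_re, Complex.div_ofReal_re, Complex.div_ofReal_im, hv, hvi]
  have h1 : 0 ≤ (Complex.exp (w + (u - κ * w))).re := by
    rw [Complex.exp_re, Complex.add_im, hvi]
    refine mul_nonneg (Real.exp_pos _).le (Real.cos_nonneg_of_mem_Icc ?_)
    rw [Set.mem_Icc, ← abs_le]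
    have : |w.im + -(κ * w.im)| = (1 - κ) * |w.im| := by
      rw [show w.im + -(κ * w.im) = (1 - κ) * w.im by ring, abs_mul,
        abs_of_nonneg (show 0 ≤ 1 - κ by linarith)]
    rw [this]
    nlinarith [mul_le_mul_of_nonneg_left hw.le (show 0 ≤ 1 - κ by linarith)]
  have h2 : Real.cos (κ * α * Real.pi / 2 / b) ≤ Real.cos (-(κ * w.im) / b) := by
    refine cos_le_cos_of_abs_le ?_ ?_
    · rw [abs_div, abs_neg, abs_mul, abs_of_nonneg hκ, abs_of_pos hb]
      gcongr
      nlinarith [mul_le_mul_of_nonneg_left hw.le hκ]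
    · rw [div_le_iff₀ hb]
      nlinarith
  rw [Complex.sub_re, Complex.sub_re, e1, e2]
  nlinarith [mul_le_mul_of_nonneg_left h2 (Real.exp_pos ((u - κ * w.re) / b)).le]

/-! ### Differentiation and uniform bounds of the kernel on the sector -/

section

variable {b κ α : ℝ}

theorem cos_pos_of_lt (hb : 0 < b) (hκ : 0 ≤ κ) (hα : 0 < α) (hαb : κ * α < b) :
    0 < Real.cos (κ * α * Real.pi / 2 / b) := by
  have hπ := Real.pi_pos
  have : 0 ≤ κ * α * Real.pi / 2 / b := by positivity
  refine Real.cos_pos_of_mem_Ioo ⟨by linarith, ?_⟩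
  rw [div_lt_iff₀ hb]
  nlinarith

theorem hasDerivAt_kernelIntegrand_right (b κ : ℝ) (j : ℕ) (w : ℂ) (u : ℝ) :
    HasDerivAt (kernelIntegrand b κ j w) (kernelIntegrand b κ j w u * ((j + 1) -
      Complex.exp (w + (u - κ * w)) - Complex.exp ((u - κ * w) / b) / b)) u := by
  have h0 : HasDerivAt (fun u : ℝ => (u : ℂ) - κ * w) 1 u :=
    (Complex.ofRealCLM.hasDerivAt (x := u)).sub_const _
  have h1 := ((h0.const_mul ((j : ℂ) + 1)).sub (h0.const_add w).cexp).sub (h0.div_const (b : ℂ)).cexp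
  refine h1.cexp.congr_deriv ?_
  simp only [kernelIntegrand, Pi.sub_apply]
  ring

/-- The dependence on `w` through `u - κ w` only moves the contour: it contributes `-κ` times the
`u`-derivative of the integrand, which integrates to zero. The remaining term is the derivative in
`z`. -/
theorem hasDerivAt_kernelIntegrand_left (b κ : ℝ) (j : ℕ) (w : ℂ) (u : ℝ) :
    HasDerivAt (fun w => kernelIntegrand b κ j w u)
      (-(Complex.exp w * kernelIntegrand b κ (j + 1) w u) -
        κ * (kernelIntegrand b κ j w u * ((j + 1) -
          Complex.exp (w + (u - κ * w)) - Complex.exp ((u - κ * w) / b) / b))) w := by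
  have h0 : HasDerivAt (fun w : ℂ => (u : ℂ) - κ * w) (-(κ * 1)) w :=
    ((hasDerivAt_id w).const_mul (κ : ℂ)).const_sub _
  have h1 := ((h0.const_mul ((j : ℂ) + 1)).sub ((hasDerivAt_id w).add h0).cexp).sub
    (h0.div_const (b : ℂ)).cexp
  refine h1.cexp.congr_deriv ?_
  have e : Complex.exp w * kernelIntegrand b κ (j + 1) w u =
      kernelIntegrand b κ j w u * Complex.exp (w + (u - κ * w)) := by
    simp only [kernelIntegrand]
    rw [← Complex.exp_add, ← Complex.exp_add]
    congr 1
    push_cast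
    ring
  rw [e]
  simp only [kernelIntegrand, Pi.sub_apply, Pi.add_apply, id]
  ring

theorem exists_norm_kernelIntegrand_le (hb : 0 < b) (hκ : 0 ≤ κ) (hκ1 : κ ≤ 1) (hα0 : 0 < α)
    (hα : (1 - κ) * α ≤ 1) (hαb : κ * α < b) (j : ℕ) :
    ∃ K : ℝ, 0 < K ∧ ∀ w : ℂ, |w.im| < α * Real.pi / 2 → ∀ u : ℝ,
      ‖kernelIntegrand b κ j w u‖ ≤ K * Real.exp (-|u - κ * w.re|) := by
  obtain ⟨K, hK0, hK⟩ := exists_exp_mul_sub_exp_div_le (A := j + 1) (by simp) hb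
    (cos_pos_of_lt hb hκ hα0 hαb)
  exact ⟨K, hK0, fun w hw u =>
    (norm_kernelIntegrand_le hb hκ hκ1 hα hαb.le j hw u).trans (hK _)⟩

theorem exists_norm_deriv_kernelIntegrand_le (hb : 0 < b) (hκ : 0 ≤ κ) (hκ1 : κ ≤ 1) (hα0 : 0 < α)
    (hα : (1 - κ) * α ≤ 1) (hαb : κ * α < b) (j : ℕ) :
    ∃ K : ℝ, 0 < K ∧ ∀ w : ℂ, |w.im| < α * Real.pi / 2 → ∀ u : ℝ,
      ‖kernelIntegrand b κ j w u * ((j + 1) -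
          Complex.exp (w + (u - κ * w)) - Complex.exp ((u - κ * w) / b) / b)‖ ≤
        (K * (1 + Real.exp w.re)) * Real.exp (-|u - κ * w.re|) := by
  obtain ⟨K₁, hK₁, h₁⟩ := exists_norm_kernelIntegrand_le hb hκ hκ1 hα0 hα hαb j
  obtain ⟨K₂, hK₂, h₂⟩ := exists_norm_kernelIntegrand_le hb hκ hκ1 hα0 hα hαb (j + 1)
  -- The extra `1 / b` in the exponent absorbs the factor `exp ((u - κ w) / b)` of the third term.
  obtain ⟨K₃, hK₃, h₃⟩ := exists_exp_mul_sub_exp_div_le (A := j + 1 + 1 / b)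
    (by have : 0 < 1 / b := by positivity
        have : (0 : ℝ) ≤ j := by positivity
        linarith) hb (cos_pos_of_lt hb hκ hα0 hαb)
  refine ⟨K₁ * (j + 1) + K₂ + K₃ / b, by positivity, fun w hw u => ?_⟩
  have e2 : kernelIntegrand b κ j w u * Complex.exp (w + (u - κ * w)) =
      Complex.exp w * kernelIntegrand b κ (j + 1) w u := by
    simp only [kernelIntegrand]
    rw [← Complex.exp_add, ← Complex.exp_add]
    congr 1
    push_cast
    ring
  have b1 : ‖kernelIntegrand b κ j w u * ((j : ℂ) + 1)‖ ≤
      K₁ * (j + 1) * Real.exp (-|u - κ * w.re|) := by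
    have : ‖(j : ℂ) + 1‖ = j + 1 := by
      rw [show (j : ℂ) + 1 = ((j + 1 : ℕ) : ℂ) by push_cast; ring, Complex.norm_natCast]
      push_cast; ring
    rw [norm_mul, this]
    have := h₁ w hw u
    nlinarith [mul_le_mul_of_nonneg_right this (show (0 : ℝ) ≤ j + 1 by positivity)]
  have b2 : ‖kernelIntegrand b κ j w u * Complex.exp (w + (u - κ * w))‖ ≤
      K₂ * Real.exp w.re * Real.exp (-|u - κ * w.re|) := by
    rw [e2, norm_mul, Complex.norm_exp]
    nlinarith [mul_le_mul_of_nonneg_left (h₂ w hw u) (Real.exp_pos w.re).le]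
  have b3 : ‖kernelIntegrand b κ j w u * (Complex.exp ((u - κ * w) / b) / b)‖ ≤
      K₃ / b * Real.exp (-|u - κ * w.re|) := by
    have e3 : ‖Complex.exp ((u - κ * w) / b)‖ = Real.exp ((u - κ * w.re) / b) := by
      rw [Complex.norm_exp, Complex.div_ofReal_re]; simp
    rw [← mul_div_assoc, norm_div, norm_mul, e3, Complex.norm_real, Real.norm_of_nonneg hb.le,
      div_mul_eq_mul_div]
    refine div_le_div_of_nonneg_right ?_ hb.le
    refine (mul_le_mul_of_nonneg_right (norm_kernelIntegrand_le hb hκ hκ1 hα hαb.le j hw u)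
      (Real.exp_pos _).le).trans ?_
    rw [← Real.exp_add]
    refine le_trans (le_of_eq ?_) (h₃ (u - κ * w.re))
    congr 1
    ring
  rw [mul_sub, mul_sub]
  refine (norm_sub_le _ _).trans ((add_le_add (norm_sub_le _ _) le_rfl).trans ?_)
  refine (add_le_add (add_le_add b1 b2) b3).trans ?_
  rw [← add_mul, ← add_mul]
  gcongr
  have := Real.exp_pos w.re
  have : 0 < K₃ / b := by positivity
  have : 0 < K₁ * (j + 1) := by positivity
  nlinarith [mul_pos this (Real.exp_pos w.re), mul_pos (show 0 < K₃ / b by positivity)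
    (Real.exp_pos w.re)]

theorem integrable_kernelIntegrand (hb : 0 < b) (hκ : 0 ≤ κ) (hκ1 : κ ≤ 1) (hα0 : 0 < α)
    (hα : (1 - κ) * α ≤ 1) (hαb : κ * α < b) (j : ℕ) {w : ℂ} (hw : |w.im| < α * Real.pi / 2) :
    Integrable (kernelIntegrand b κ j w) := by
  obtain ⟨K, -, h⟩ := exists_norm_kernelIntegrand_le hb hκ hκ1 hα0 hα hαb j
  exact integrable_of_norm_le_exp_neg_abs (continuous_kernelIntegrand b κ j w) (h w hw)

theorem hasDerivAt_kernel (hb : 0 < b) (hκ : 0 ≤ κ) (hκ1 : κ ≤ 1) (hα0 : 0 < α)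
    (hα : (1 - κ) * α ≤ 1) (hαb : κ * α < b) (j : ℕ) {w : ℂ} (hw : |w.im| < α * Real.pi / 2) :
    HasDerivAt (kernel b κ j) (-Complex.exp w * kernel b κ (j + 1) w) w := by
  obtain ⟨K₁, hK₁, h₁⟩ := exists_norm_kernelIntegrand_le hb hκ hκ1 hα0 hα hαb (j + 1)
  obtain ⟨K₂, hK₂, h₂⟩ := exists_norm_deriv_kernelIntegrand_le hb hκ hκ1 hα0 hα hαb j
  have hopen : IsOpen {w : ℂ | |w.im| < α * Real.pi / 2} := isOpen_lt (by fun_prop) (by fun_prop)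
  obtain ⟨r, hr, hrw⟩ := Metric.isOpen_iff.1 hopen w hw
  set F' : ℂ → ℝ → ℂ := fun w u => -(Complex.exp w * kernelIntegrand b κ (j + 1) w u) -
        κ * (kernelIntegrand b κ j w u * ((j + 1) -
          Complex.exp (w + (u - κ * w)) - Complex.exp ((u - κ * w) / b) / b)) with hF'
  have hcont2 : Continuous fun u : ℝ => kernelIntegrand b κ j w u * ((j + 1) -
          Complex.exp (w + (u - κ * w)) - Complex.exp ((u - κ * w) / b) / b) :=
    (continuous_kernelIntegrand b κ j w).mul (by fun_prop)
  have hint2 := integrable_of_norm_le_exp_neg_abs hcont2 (h₂ w hw)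
  have hint1 := integrable_kernelIntegrand hb hκ hκ1 hα0 hα hαb (j + 1) hw
  -- Radius at most `r` stays in the strip; radius at most `1` shifts the centre of the dominating
  -- function by at most `κ`, at the cost of a factor `exp κ`.
  have hs : Metric.ball w (min r 1) ∈ 𝓝 w := Metric.ball_mem_nhds w (by positivity)
  have hbound : ∀ u : ℝ, ∀ v ∈ Metric.ball w (min r 1), ‖F' v u‖ ≤
      ((Real.exp (w.re + 1) * K₁ + κ * (K₂ * (1 + Real.exp (w.re + 1)))) * Real.exp κ) *
        Real.exp (-|u - κ * w.re|) := by
    intro u v hv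
    have hv1 : |v.im| < α * Real.pi / 2 := hrw (Metric.ball_subset_ball (min_le_left _ _) hv)
    have hv2 : |v.re - w.re| ≤ 1 := by
      have h := (Complex.abs_re_le_norm (v - w)).trans
        ((mem_ball_iff_norm.1 hv).le.trans (min_le_right _ _))
      simpa using h
    have hre : v.re ≤ w.re + 1 := by linarith [(abs_le.1 hv2).2]
    have hexp : Real.exp (-|u - κ * v.re|) ≤ Real.exp κ * Real.exp (-|u - κ * w.re|) := by
      rw [← Real.exp_add, Real.exp_le_exp]
      have h3 : |u - κ * w.re| ≤ |u - κ * v.re| + |κ * (v.re - w.re)| := by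
        have := abs_add_le (u - κ * v.re) (κ * (v.re - w.re))
        rwa [show u - κ * v.re + κ * (v.re - w.re) = u - κ * w.re by ring] at this
      rw [abs_mul, abs_of_nonneg hκ] at h3
      nlinarith
    have h4 := h₁ v hv1 u
    have h5 := h₂ v hv1 u
    have h6 : Real.exp v.re ≤ Real.exp (w.re + 1) := Real.exp_le_exp.2 hre
    calc ‖F' v u‖ ≤ Real.exp v.re * (K₁ * Real.exp (-|u - κ * v.re|)) +
          κ * ((K₂ * (1 + Real.exp v.re)) * Real.exp (-|u - κ * v.re|)) := by
          refine (norm_sub_le _ _).trans (add_le_add ?_ ?_)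
          · rw [norm_neg, norm_mul, Complex.norm_exp]
            gcongr
          · rw [norm_mul, Complex.norm_real, Real.norm_of_nonneg hκ]
            gcongr
      _ = (Real.exp v.re * K₁ + κ * (K₂ * (1 + Real.exp v.re))) * Real.exp (-|u - κ * v.re|) := by
          ring
      _ ≤ (Real.exp (w.re + 1) * K₁ + κ * (K₂ * (1 + Real.exp (w.re + 1)))) *
          (Real.exp κ * Real.exp (-|u - κ * w.re|)) := by gcongr
      _ = _ := by ring
  have key := (hasDerivAt_integral_of_dominated_loc_of_deriv_le (μ := volume)
    (F := kernelIntegrand b κ j) (F' := F') hs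
    (Eventually.of_forall fun v => (continuous_kernelIntegrand b κ j v).aestronglyMeasurable)
    (integrable_kernelIntegrand hb hκ hκ1 hα0 hα hαb j hw)
    ((((continuous_kernelIntegrand b κ (j + 1) w).const_mul _).neg.sub
      (hcont2.const_mul _)).aestronglyMeasurable)
    (Eventually.of_forall hbound) ((integrable_exp_neg_abs_sub _).const_mul _)
    (Eventually.of_forall fun u v _ => hasDerivAt_kernelIntegrand_left b κ j v u)).2
  refine key.congr_deriv ?_
  calc ∫ u, F' w u = (∫ u, -(Complex.exp w * kernelIntegrand b κ (j + 1) w u)) -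
        ∫ u : ℝ, κ * (kernelIntegrand b κ j w u * ((j + 1) -
          Complex.exp (w + (u - κ * w)) - Complex.exp ((u - κ * w) / b) / b)) :=
        integral_sub (hint1.const_mul _).neg (hint2.const_mul _)
    _ = -Complex.exp w * kernel b κ (j + 1) w := by
        rw [integral_neg, integral_const_mul, integral_const_mul,
          integral_eq_zero_of_hasDerivAt_of_integrable
            (fun u => hasDerivAt_kernelIntegrand_right b κ j w u) hint2
            (integrable_kernelIntegrand hb hκ hκ1 hα0 hα hαb j hw)]
        simp [kernel]

theorem exists_norm_kernel_le (hb : 0 < b) (hκ : 0 ≤ κ) (hκ1 : κ ≤ 1) (hα0 : 0 < α)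
    (hα : (1 - κ) * α ≤ 1) (hαb : κ * α < b) :
    ∃ C h : ℝ, 0 < C ∧ 0 < h ∧ ∀ j : ℕ, ∀ w : ℂ, |w.im| < α * Real.pi / 2 →
      ‖kernel b κ j w‖ ≤ C * h ^ j * gevreyBar b j := by
  have hc := cos_pos_of_lt hb hκ hα0 hαb
  set c := Real.cos (κ * α * Real.pi / 2 / b)
  -- Half of the decay produces the Gevrey factor and the other half keeps the integral finite.
  -- Translation invariance then removes `w`.
  have hc2 : 0 < c / 2 := by positivity
  have hint : Integrable fun u : ℝ => Real.exp (1 * u - c / 2 * Real.exp (u / b)) :=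
    integrable_exp_mul_sub_exp_div le_rfl hb hc2
  refine ⟨max 1 (∫ u : ℝ, Real.exp (1 * u - c / 2 * Real.exp (u / b))),
    Real.exp (b * Real.log (b / (c / 2))), by positivity, Real.exp_pos _, fun j w hw => ?_⟩
  have hg : 0 ≤ gevreyBar b j := by rw [gevreyBar_eq_exp]; positivity
  calc ‖kernel b κ j w‖ ≤ ∫ u : ℝ, Real.exp (b * Real.log (b / (c / 2))) ^ j * gevreyBar b j *
        Real.exp (1 * (u - κ * w.re) - c / 2 * Real.exp ((u - κ * w.re) / b)) := by
        refine norm_integral_le_of_norm_le ((hint.comp_sub_right (κ * w.re)).const_mul _)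
          (Eventually.of_forall fun u => ?_)
        refine (norm_kernelIntegrand_le hb hκ hκ1 hα hαb.le j hw u).trans ?_
        refine le_trans (le_of_eq ?_) (mul_le_mul_of_nonneg_right
          (exp_nat_mul_sub_exp_div_le hb hc2 j (u - κ * w.re)) (Real.exp_pos _).le)
        rw [← Real.exp_add]
        congr 1
        ring
    _ = Real.exp (b * Real.log (b / (c / 2))) ^ j * gevreyBar b j *
        ∫ u : ℝ, Real.exp (1 * u - c / 2 * Real.exp (u / b)) := by
        rw [integral_const_mul, integral_sub_right_eq_self
          (fun u : ℝ => Real.exp (1 * u - c / 2 * Real.exp (u / b)))]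
    _ ≤ Real.exp (b * Real.log (b / (c / 2))) ^ j * gevreyBar b j *
        max 1 (∫ u : ℝ, Real.exp (1 * u - c / 2 * Real.exp (u / b))) := by
        gcongr
        exact le_max_right _ _
    _ = _ := by ring

end

/-! ### Positivity and lower bounds of the kernel on the positive ray -/

theorem kernel_ofReal (b κ : ℝ) (j : ℕ) (x : ℝ) :
    kernel b κ j x = (realKernel b j x : ℂ) := by
  rw [realKernel, ← integral_sub_right_eq_self _ (κ * x), ← integral_complex_ofReal, kernel]
  refine integral_congr_ae (Eventually.of_forall fun u => ?_)
  simp [kernelIntegrand]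

theorem realKernel_nonneg (b : ℝ) (j : ℕ) (x : ℝ) : 0 ≤ realKernel b j x :=
  integral_nonneg fun _ => (Real.exp_pos _).le

/-- It suffices to integrate over `u ∈ [b log j, b log j + 1]`, that is `t` of size `j ^ b`, where
`t ^ j exp (-t ^ (1 / b))` already has Gevrey size up to a geometric factor. The choice of `X` keeps
`z t ≤ 1` there. -/
theorem exists_le_realKernel {b : ℝ} (hb : 0 < b) :
    ∃ c h : ℝ, 0 < c ∧ 0 < h ∧ ∀ j : ℕ, ∃ X : ℝ, ∀ x ≤ X,
      c * h ^ j * gevreyBar b j ≤ realKernel b j x := by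
  refine ⟨Real.exp (-1 - Real.exp (1 / b)), Real.exp (-Real.exp (1 / b)), Real.exp_pos _,
    Real.exp_pos _, fun j => ⟨-(b * Real.log j + 1), fun x hx => ?_⟩⟩
  have hint : Integrable fun u : ℝ =>
      Real.exp ((j + 1) * u - Real.exp (x + u) - Real.exp (u / b)) := by
    refine (integrable_exp_mul_sub_exp_div (A := j + 1) (by simp) hb one_pos).mono' (by fun_prop)
      (Eventually.of_forall fun u => ?_)
    rw [Real.norm_of_nonneg (Real.exp_pos _).le, Real.exp_le_exp]
    linarith [Real.exp_pos (x + u)]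
  set a := b * Real.log j with ha
  have hlog : 0 ≤ Real.log j := Real.log_natCast_nonneg j
  have hle : ∀ u ∈ Set.Icc a (a + 1),
      Real.exp (-1 - Real.exp (1 / b)) * Real.exp (-Real.exp (1 / b)) ^ j * gevreyBar b j ≤
        Real.exp ((j + 1) * u - Real.exp (x + u) - Real.exp (u / b)) := by
    rintro u ⟨hu1, hu2⟩
    rw [gevreyBar_eq_exp, ← Real.exp_nat_mul, ← Real.exp_add, ← Real.exp_add, Real.exp_le_exp]
    have h1 : Real.exp (x + u) ≤ 1 := by
      rw [Real.exp_le_one_iff]; linarith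
    have h2 : Real.exp (u / b) ≤ (j + 1) * Real.exp (1 / b) := by
      have h3 : u / b ≤ Real.log j + 1 / b := by
        rw [div_le_iff₀ hb, add_mul, div_mul_cancel₀ _ hb.ne']
        linarith
      refine (Real.exp_le_exp.2 h3).trans ?_
      rw [Real.exp_add]
      gcongr
      rcases Nat.eq_zero_or_pos j with rfl | hj
      · simp
      · rw [Real.exp_log (by exact_mod_cast hj)]; linarith
    have h4 : (j + 1) * a ≤ (j + 1) * u := by gcongr
    have h5 : 0 ≤ a := by positivity
    have h6 : (j : ℝ) * b * Real.log j = j * a := by rw [ha]; ring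
    rw [h6]
    linarith
  calc _ = ∫ _ in Set.Icc a (a + 1), Real.exp (-1 - Real.exp (1 / b)) *
        Real.exp (-Real.exp (1 / b)) ^ j * gevreyBar b j := by
        rw [setIntegral_const]; simp
    _ ≤ ∫ u in Set.Icc a (a + 1), Real.exp ((j + 1) * u - Real.exp (x + u) - Real.exp (u / b)) :=
        setIntegral_mono_on (integrable_const _) hint.integrableOn measurableSet_Icc hle
    _ ≤ realKernel b j x :=
        setIntegral_le_integral hint (Eventually.of_forall fun u => (Real.exp_pos _).le)

/-! ### Characteristic functions of ultraholomorphic classes -/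

/-- The quotients `L (i + 1) / L i` increase with `i`, so for `μ = L (k + 1) / L k` the sequence `i
↦ L i / μ ^ i` decreases up to `k` and increases afterwards: its minimum is at `i = k`. -/
theorem LogConvex.mul_quotient_pow_le {L : ℕ → ℝ} (hL : LogConvex L) (hpos : ∀ j, 0 < L j)
    (j k : ℕ) : L k * (L (k + 1) / L k) ^ j ≤ L j * (L (k + 1) / L k) ^ k := by
  have hμ : ∀ k, 0 < L (k + 1) / L k := fun k => div_pos (hpos _) (hpos _)
  have hmono : Monotone fun k => L (k + 1) / L k := by
    refine monotone_nat_of_le_succ fun k => ?_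
    rw [div_le_div_iff₀ (hpos _) (hpos _)]
    have := hL k
    nlinarith
  have hsucc : ∀ k, L (k + 1) = L k * (L (k + 1) / L k) := fun k => by
    have := (hpos k).ne'
    field_simp
  rcases le_total k j with h | h
  · obtain ⟨i, rfl⟩ := Nat.exists_eq_add_of_le h
    induction i with
    | zero => simp
    | succ i ih =>
      rw [← add_assoc, pow_succ, hsucc (k + i)]
      have h1 := ih (Nat.le_add_right _ _)
      have h2 : L (k + 1) / L k ≤ L (k + i + 1) / L (k + i) := hmono (Nat.le_add_right k i)
      have h3 := hμ k
      have h4 := hpos (k + i)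
      calc _ = L k * (L (k + 1) / L k) ^ (k + i) * (L (k + 1) / L k) := by ring
        _ ≤ L (k + i) * (L (k + 1) / L k) ^ k * (L (k + i + 1) / L (k + i)) := by gcongr
        _ = _ := by ring
  · obtain ⟨i, rfl⟩ := Nat.exists_eq_add_of_le h
    suffices H : ∀ i m, j + i ≤ m → L (j + i) ≤ L j * (L (m + 1) / L m) ^ i by
      have h3 := hμ (j + i)
      calc _ ≤ L j * (L (j + i + 1) / L (j + i)) ^ i * (L (j + i + 1) / L (j + i)) ^ j := by
            gcongr
            exact H i _ le_rfl
        _ = _ := by rw [mul_assoc, ← pow_add, add_comm i j]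
    intro i m hm
    induction i with
    | zero => simp
    | succ i ih =>
      have h1 := ih (by omega)
      have h2 : L (j + i + 1) / L (j + i) ≤ L (m + 1) / L m := hmono (by omega)
      have h3 := hμ m
      have h4 := hpos j
      have h5 := hμ (j + i)
      rw [← add_assoc, hsucc (j + i), pow_succ, ← mul_assoc]
      gcongr

theorem exists_characteristic_function {α a : ℝ} (hα : 1 < α) (ha : α < a) {L : ℕ → ℝ}
    (hpos : ∀ j, 0 < L j) (hL : LogConvex L) :
    ∃ f : LogSurface → ℂ, HolomorphicOn f (sector α) ∧
      (∃ C h : ℝ, 0 < C ∧ 0 < h ∧ ∀ z ∈ sector α, ∀ j : ℕ,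
        ‖(zderiv^[j] f) z‖ ≤ C * h ^ j * (gevreyBar (a - 1) j * L j)) ∧
      ∃ r : ℕ → ℝ → ℝ, (∀ (j : ℕ) (x : ℝ), (zderiv^[j] f) ⟨x⟩ = (-1) ^ j * (r j x : ℂ)) ∧
        (∀ j x, 0 ≤ r j x) ∧
        ∃ c h : ℝ, 0 < c ∧ 0 < h ∧ ∀ j : ℕ, ∃ x : ℝ,
          c * h ^ j * (gevreyBar (a - 1) j * L j) ≤ r j x := by
  have hα0 : 0 < α := by linarith
  set b := a - 1 with hbdef
  have hb : 0 < b := by linarith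
  -- This choice gives `(1 - κ) α = 1`, so `z t` stays in the right half-plane, and `κ α = α - 1 <
  -- b`, so `t ^ (1 / b)` stays in a strictly smaller sector.
  set κ := (α - 1) / α with hκdef
  have hκα : κ * α = α - 1 := by rw [hκdef]; field_simp
  have hκ : 0 ≤ κ := div_nonneg (by linarith) hα0.le
  have hκ1 : κ ≤ 1 := by rw [hκdef, div_le_one hα0]; linarith
  have h1κ : (1 - κ) * α ≤ 1 := by nlinarith
  have hκb : κ * α < b := by linarith
  obtain ⟨C, h, hC, hh, hker⟩ := exists_norm_kernel_le hb hκ hκ1 hα0 h1κ hκb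
  obtain ⟨c, h', hc, hh', hlow⟩ := exists_le_realKernel hb
  set μ : ℕ → ℝ := fun k => L (k + 1) / L k with hμdef
  have hμ : ∀ k, 0 < μ k := fun k => div_pos (hpos _) (hpos _)
  -- Differentiating `j` times multiplies the `k`-th weight by `μ k ^ j`. The result is at most `(1
  -- / 2) ^ k * L j`, with equality at `k = j`: one choice serves the upper and the lower bound.
  set d : ℕ → ℝ := fun k => (1 / 2) ^ k * (L k / μ k ^ k) with hd
  have hd0 : ∀ k j, 0 < d k * μ k ^ j := fun k j => by
    have := hμ k
    have := hpos k
    positivity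
  have hdj : ∀ k j, d k * μ k ^ j ≤ (1 / 2) ^ k * L j := fun k j => by
    have h1 := hL.mul_quotient_pow_le hpos j k
    have h2 := hμ k
    rw [hd, mul_assoc]
    gcongr
    rw [div_mul_eq_mul_div, div_le_iff₀ (by positivity)]
    exact h1
  have hgev : ∀ j, 0 < gevreyBar b j := fun j => by rw [gevreyBar_eq_exp]; positivity
  have hshift : ∀ (w : ℂ) (k : ℕ), (w + (Real.log (μ k) : ℂ)).im = w.im := fun w k => by simp
  -- the bound for a single summand
  have hterm : ∀ (j : ℕ) (w : ℂ), |w.im| < α * Real.pi / 2 → ∀ k,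
      ‖((d k * μ k ^ j : ℝ) : ℂ) * kernel b κ j (w + (Real.log (μ k) : ℂ))‖ ≤
        (1 / 2) ^ k * (C * h ^ j * (gevreyBar b j * L j)) := by
    intro j w hw k
    have h1 := hker j (w + (Real.log (μ k) : ℂ)) (by rwa [hshift])
    have h2 := hd0 k j
    have h3 := hgev j
    have h4 := hpos j
    rw [norm_mul, Complex.norm_real, Real.norm_of_nonneg h2.le]
    calc _ ≤ ((1 / 2) ^ k * L j) * (C * h ^ j * gevreyBar b j) :=
          mul_le_mul (hdj k j) h1 (norm_nonneg _) (by positivity)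
      _ = _ := by ring
  have hgeo : ∀ B : ℝ, Summable fun k : ℕ => (1 / 2 : ℝ) ^ k * B := fun B =>
    summable_geometric_two.mul_right B
  set F : ℕ → ℂ → ℂ := fun j w =>
    ∑' k, ((d k * μ k ^ j : ℝ) : ℂ) * kernel b κ j (w + (Real.log (μ k) : ℂ)) with hF
  have hFnorm : ∀ (j : ℕ) (w : ℂ), |w.im| < α * Real.pi / 2 →
      ‖F j w‖ ≤ 2 * (C * h ^ j * (gevreyBar b j * L j)) := by
    intro j w hw
    have h1 := tsum_of_norm_bounded ((hgeo (C * h ^ j * (gevreyBar b j * L j))).hasSum)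
      (hterm j w hw)
    rwa [tsum_mul_right, tsum_geometric_two] at h1
  have hFderiv : ∀ (j : ℕ) (w : ℂ), |w.im| < α * Real.pi / 2 →
      HasDerivAt (F j) (-Complex.exp w * F (j + 1) w) w := by
    intro j w hw
    have hopen : IsOpen {w : ℂ | |w.im| < α * Real.pi / 2} := isOpen_lt (by fun_prop) (by fun_prop)
    obtain ⟨r, hr, hrw⟩ := Metric.isOpen_iff.1 hopen w hw
    have hmem : ∀ v ∈ Metric.ball w (min r 1), |v.im| < α * Real.pi / 2 ∧ v.re ≤ w.re + 1 := by
      intro v hv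
      refine ⟨hrw (Metric.ball_subset_ball (min_le_left _ _) hv), ?_⟩
      have h1 := (Complex.re_le_norm (v - w)).trans
        ((mem_ball_iff_norm.1 hv).le.trans (min_le_right _ _))
      rw [Complex.sub_re] at h1
      linarith
    have hw0 : w ∈ Metric.ball w (min r 1) := Metric.mem_ball_self (by positivity)
    have key := hasDerivAt_tsum_of_isPreconnected
      (g := fun k w => ((d k * μ k ^ j : ℝ) : ℂ) * kernel b κ j (w + (Real.log (μ k) : ℂ)))
      (g' := fun k w => -Complex.exp w * (((d k * μ k ^ (j + 1) : ℝ) : ℂ) *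
        kernel b κ (j + 1) (w + (Real.log (μ k) : ℂ))))
      (u := fun k => (1 / 2) ^ k * (Real.exp (w.re + 1) *
        (C * h ^ (j + 1) * (gevreyBar b (j + 1) * L (j + 1))))) (hgeo _) Metric.isOpen_ball
      (convex_ball w (min r 1)).isPreconnected ?_ ?_ hw0
      (.of_norm_bounded (hgeo _) (hterm j w hw)) hw0
    · refine key.congr_deriv ?_
      rw [tsum_mul_left]
    · intro k v hv
      have h1 := hasDerivAt_kernel hb hκ hκ1 hα0 h1κ hκb j
        (w := v + (Real.log (μ k) : ℂ)) (by rw [hshift]; exact (hmem v hv).1)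
      have h2 := (h1.comp_add_const v (Real.log (μ k) : ℂ)).const_mul ((d k * μ k ^ j : ℝ) : ℂ)
      refine h2.congr_deriv ?_
      rw [Complex.exp_add, ← Complex.ofReal_exp, Real.exp_log (hμ k)]
      push_cast
      ring
    · intro k v hv
      have h1 := hterm (j + 1) v (hmem v hv).1 k
      rw [norm_mul, norm_neg, Complex.norm_exp]
      calc _ ≤ Real.exp (w.re + 1) *
            ((1 / 2) ^ k * (C * h ^ (j + 1) * (gevreyBar b (j + 1) * L (j + 1)))) := by
            gcongr
            exact (hmem v hv).2
        _ = _ := by ring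
  set f : LogSurface → ℂ := fun z => F 0 z.log with hf
  have hiter : ∀ (j : ℕ), ∀ z ∈ sector α, (zderiv^[j] f) z = (-1) ^ j * F j z.log := by
    intro j
    induction j with
    | zero => intro z _; simp [hf]
    | succ j ih =>
      intro z hz
      rw [Function.iterate_succ_apply', zderiv]
      have h1 : (fun w : ℂ => (zderiv^[j] f) ⟨w⟩) =ᶠ[𝓝 z.log] fun w => (-1) ^ j * F j w := by
        filter_upwards [(isOpen_sector α).mem_nhds hz] with w hw
        exact ih ⟨w⟩ hw
      rw [h1.deriv_eq, ((hFderiv j z.log hz).const_mul _).deriv]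
      have : Complex.exp (-z.log) * Complex.exp z.log = 1 := by rw [← Complex.exp_add]; simp
      linear_combination (-(-1) ^ j * F (j + 1) z.log) * this
  have hreal : ∀ x : ℝ, (⟨(x : ℂ)⟩ : LogSurface) ∈ sector α := fun x => by
    change |(x : ℂ).im| < _
    rw [Complex.ofReal_im, abs_zero]
    have := Real.pi_pos
    positivity
  set R : ℕ → ℝ → ℕ → ℝ := fun j x k => d k * μ k ^ j * realKernel b j (x + Real.log (μ k)) with hR
  have hRker : ∀ j (x : ℝ) k, ((d k * μ k ^ j : ℝ) : ℂ) * kernel b κ j (x + (Real.log (μ k) : ℂ)) =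
      (R j x k : ℂ) := fun j x k => by
    rw [hR, ← Complex.ofReal_add, kernel_ofReal, ← Complex.ofReal_mul]
  have hR0 : ∀ j x k, 0 ≤ R j x k := fun j x k =>
    mul_nonneg (hd0 k j).le (realKernel_nonneg _ _ _)
  have hRsum : ∀ j x, Summable (R j x) := fun j x => by
    refine .of_norm_bounded (hgeo (C * h ^ j * (gevreyBar b j * L j))) fun k => ?_
    rw [← Complex.norm_real, ← hRker]
    exact hterm j x (hreal x) k
  refine ⟨f, fun w hw => (hFderiv 0 w hw).differentiableAt.differentiableWithinAt,
    ⟨2 * C, h, by positivity, hh, fun z hz j => ?_⟩, fun j x => ∑' k, R j x k, fun j x => ?_,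
    fun j x => tsum_nonneg (hR0 j x), c, h' / 2, hc, by positivity, fun j => ?_⟩
  · rw [hiter j z hz, norm_mul, norm_pow, norm_neg, norm_one, one_pow, one_mul]
    refine (hFnorm j _ hz).trans (le_of_eq ?_)
    ring
  · rw [hiter j _ (hreal x), Complex.ofReal_tsum]
    simp only [hF, hRker]
  · obtain ⟨X, hX⟩ := hlow j
    -- All summands are nonnegative, so the term `k = j` alone bounds the series from below; the
    -- shift undoes the dilation by `μ j`.
    refine ⟨X - Real.log (μ j), le_trans ?_ ((hRsum j _).le_tsum j fun k _ => hR0 _ _ _)⟩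
    have h1 := hX (X - Real.log (μ j) + Real.log (μ j)) (by linarith)
    have h2 : d j * μ j ^ j = (1 / 2) ^ j * L j := by
      have := (hμ j).ne'
      rw [hd]; field_simp
    have h3 := hpos j
    calc c * (h' / 2) ^ j * (gevreyBar b j * L j) =
          (1 / 2) ^ j * L j * (c * h' ^ j * gevreyBar b j) := by
          rw [div_pow, div_pow, one_pow]; ring
      _ ≤ d j * μ j ^ j * realKernel b j (X - Real.log (μ j) + Real.log (μ j)) := by
          rw [h2]; gcongr

/-! ### Almost monotonicity of roots -/

theorem LogConvex.log_div_le {L : ℕ → ℝ} (hL : LogConvex L) (hpos : ∀ j, 0 < L j) {i k : ℕ}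
    (hi : 1 ≤ i) (hik : i ≤ k) :
    (Real.log (L i) - Real.log (L 0)) / i ≤ (Real.log (L k) - Real.log (L 0)) / k := by
  induction k, hik using Nat.le_induction with
  | base => exact le_rfl
  | succ k hk ih =>
    refine ih.trans ?_
    have hk0 : (0 : ℝ) < k := by exact_mod_cast (by omega : 0 < k)
    have h1 := hL.mul_quotient_pow_le hpos 0 k
    rw [pow_zero, mul_one] at h1
    have h2 := Real.log_le_log (hpos k) h1
    rw [Real.log_mul (hpos 0).ne' (pow_pos (div_pos (hpos _) (hpos _)) _).ne', Real.log_pow,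
      Real.log_div (hpos _).ne' (hpos _).ne'] at h2
    push_cast
    rw [div_le_div_iff₀ hk0 (by positivity)]
    nlinarith

theorem log_div_le_of_le_mul_pow {x y A B : ℝ} {j : ℕ} (hj : 1 ≤ j) (hx : 0 < x) (hy : 0 < y)
    (hA : 0 < A) (hB : 0 < B) (h : x ≤ A * B ^ j * y) :
    Real.log x / j ≤ |Real.log A| + Real.log B + Real.log y / j := by
  have hj0 : (0 : ℝ) < j := by exact_mod_cast hj
  have hj1 : (1 : ℝ) ≤ j := by exact_mod_cast hj
  have h1 := Real.log_le_log hx h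
  rw [Real.log_mul (by positivity) hy.ne', Real.log_mul hA.ne' (by positivity),
    Real.log_pow] at h1
  rw [div_le_iff₀ hj0, add_mul, div_mul_cancel₀ _ hj0.ne']
  nlinarith [le_abs_self (Real.log A), abs_nonneg (Real.log A)]

theorem gevreyBar_pos (a : ℝ) (j : ℕ) : 0 < gevreyBar a j := by
  rw [gevreyBar_eq_exp]; exact Real.exp_pos _

theorem gevreyBar_mul_gevreyBar_neg (a : ℝ) (j : ℕ) : gevreyBar a j * gevreyBar (-a) j = 1 := by
  rw [gevreyBar_eq_exp, gevreyBar_eq_exp, ← Real.exp_add]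
  simp

/-- Roots of `L j / L 0` increase by log-convexity, and the removed factor `j ^ (a j)` has root `j ^
a`, which increases as `a ≥ 0`. Equivalence and the value `L 0` cost only a constant. -/
theorem exists_log_div_le_of_equivalent {a : ℝ} (ha : 0 ≤ a) {M L : ℕ → ℝ} (hM : ∀ j, 0 < M j)
    (hpos : ∀ j, 0 < L j) (hL : LogConvex L)
    (hE : Equivalent (fun j => gevreyBar (-a) j * M j) L) :
    ∃ D : ℝ, ∀ i k : ℕ, 1 ≤ i → i ≤ k → Real.log (M i) / i ≤ D + Real.log (M k) / k := by
  obtain ⟨⟨A, B, hA, hB, h1⟩, A', B', hA', hB', h2⟩ := hE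
  refine ⟨|Real.log A| + Real.log B + |Real.log A'| + Real.log B' + 2 * |Real.log (L 0)|,
    fun i k hi hik => ?_⟩
  have hlog : ∀ j : ℕ, 1 ≤ j → Real.log (gevreyBar (-a) j * M j) / j =
      -(a * Real.log j) + Real.log (M j) / j := fun j hj => by
    have hj0 : (0 : ℝ) < j := by exact_mod_cast hj
    rw [Real.log_mul (gevreyBar_pos _ _).ne' (hM j).ne', gevreyBar_eq_exp, Real.log_exp]
    field_simp
  have e1 := log_div_le_of_le_mul_pow hi (mul_pos (gevreyBar_pos (-a) i) (hM i)) (hpos i) hA hB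
    (h1 i)
  have e2 := log_div_le_of_le_mul_pow (hi.trans hik) (hpos k)
    (mul_pos (gevreyBar_pos (-a) k) (hM k)) hA' hB' (h2 k)
  rw [hlog i hi] at e1
  rw [hlog k (hi.trans hik)] at e2
  have e3 := hL.log_div_le hpos hi hik
  rw [sub_div, sub_div] at e3
  have hbd : ∀ j : ℕ, 1 ≤ j → |Real.log (L 0) / j| ≤ |Real.log (L 0)| := fun j hj => by
    rw [abs_div, Nat.abs_cast]
    exact div_le_self (abs_nonneg _) (by exact_mod_cast hj)
  have e4 := (le_abs_self _).trans (hbd i hi)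
  have e5 := (neg_abs_le (Real.log (L 0) / k))
  have e6 := hbd k (hi.trans hik)
  have e7 : a * Real.log i ≤ a * Real.log k := by
    have : (0 : ℝ) < i := by exact_mod_cast hi
    gcongr
  linarith

theorem log_factorial_div_le {i k : ℕ} (hi : 1 ≤ i) (hik : i ≤ k) (hk : k ≤ 2 * i) :
    Real.log k.factorial / k ≤ Real.log 2 + 1 + Real.log i.factorial / i := by
  have hi0 : (0 : ℝ) < i := by exact_mod_cast hi
  have hk0 : (0 : ℝ) < k := by exact_mod_cast hi.trans hik
  have h1 : Real.log k.factorial / k ≤ Real.log k := by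
    rw [div_le_iff₀ hk0, mul_comm, ← Real.log_pow]
    exact Real.log_le_log (by positivity) (by exact_mod_cast Nat.factorial_le_pow k)
  have h2 : Real.log i - 1 ≤ Real.log i.factorial / i := by
    rw [le_div_iff₀ hi0]
    have h3 := Real.pow_div_factorial_le_exp (i : ℝ) hi0.le i
    have h4 := Real.log_le_log (by positivity) h3
    rw [Real.log_div (by positivity) (by positivity), Real.log_pow, Real.log_exp] at h4
    linarith
  have h5 : Real.log k ≤ Real.log 2 + Real.log i := by
    rw [← Real.log_mul (by norm_num) hi0.ne']
    exact Real.log_le_log hk0 (by exact_mod_cast hk)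
  linarith

/-- Dividing by `j!` may destroy the monotonicity of roots in general, but for `i ≤ k ≤ 2 i` the
roots of `i!` and `k!` are comparable. -/
theorem exists_log_check_div_le_of_equivalent {a : ℝ} (ha : 0 ≤ a) {M L : ℕ → ℝ}
    (hM : ∀ j, 0 < M j) (hpos : ∀ j, 0 < L j) (hL : LogConvex L)
    (hE : Equivalent (fun j => gevreyBar (-a) j * M j) L) :
    ∃ D : ℝ, ∀ i k : ℕ, 1 ≤ i → i ≤ k → k ≤ 2 * i →
      Real.log (check M i) / i ≤ D + Real.log (check M k) / k := by
  obtain ⟨D, hD⟩ := exists_log_div_le_of_equivalent ha hM hpos hL hE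
  refine ⟨D + Real.log 2 + 1, fun i k hi hik hk => ?_⟩
  have h1 := hD i k hi hik
  have h2 := log_factorial_div_le hi hik hk
  rw [check, check, Real.log_div (hM i).ne' (by positivity), Real.log_div (hM k).ne'
    (by positivity), sub_div, sub_div]
  linarith

/-! ### Derivatives of the reciprocal -/

theorem sum_choose_mul_zderiv_eq_zero {f u : LogSurface → ℂ} {S : Set LogSurface}
    (hf : HolomorphicOn f S) (hu : HolomorphicOn u S)
    (hS : IsOpen {w : ℂ | (⟨w⟩ : LogSurface) ∈ S}) (hfu : ∀ z ∈ S, f z * u z = 1)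
    {z : LogSurface} (hz : z ∈ S) {n : ℕ} (hn : n ≠ 0) :
    ∑ i ∈ Finset.range (n + 1),
      (n.choose i : ℂ) * (zderiv^[i] f) z * (zderiv^[n - i] u) z = 0 := by
  obtain ⟨w⟩ := z
  have h1 := iteratedDeriv_fun_mul (n := n) (analyticAt_branch hf hS hz).contDiffAt
    (analyticAt_branch hu hS hz).contDiffAt
  have h2 : (fun ζ => branch f w ζ * branch u w ζ) =ᶠ[𝓝 (Complex.exp w)] fun _ => 1 := by
    filter_upwards [eventually_branch_log_mem hS hz] with ζ hζ
    exact hfu _ hζ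
  rw [h2.iteratedDeriv_eq, iteratedDeriv_const, if_neg hn] at h1
  simpa only [iteratedDeriv_branch hf hS hz, iteratedDeriv_branch hu hS hz] using h1.symm

/-- If the coefficients of a power series `φ` are nonnegative up to the sign `(-1) ^ i` and
`Λ > φ 0`, then so are those of `1 / (Λ - φ)`, and they dominate those of a single power of a
monomial of `φ`. -/
theorem pow_div_le_norm_of_reciprocal {a : ℕ → ℝ} (ha : ∀ i, 0 ≤ a i) {Λ : ℝ} (hΛ : a 0 < Λ)
    {f u : ℕ → ℂ} (hf0 : f 0 = Λ - a 0) (hf : ∀ i, f (i + 1) = -((-1) ^ (i + 1) * (a (i + 1) : ℂ)))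
    (hu0 : f 0 * u 0 = 1)
    (hu : ∀ n : ℕ, n ≠ 0 → ∑ i ∈ Finset.range (n + 1), (n.choose i : ℂ) * f i * u (n - i) = 0)
    {j : ℕ} (hj : 1 ≤ j) (m : ℕ) :
    (a j / j.factorial / Λ) ^ m / Λ ≤ ‖u (j * m)‖ / (j * m).factorial := by
  have hΛ0 : 0 < Λ := (ha 0).trans_lt hΛ
  have hd : 0 < Λ - a 0 := by linarith
  set s : ℕ → ℂ := fun n => (-1) ^ n * u n / n.factorial with hs
  -- In terms of the sign-adjusted coefficients `s`, the Leibniz relations become a recursion with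
  -- nonnegative coefficients.
  have hrec : ∀ n, ((Λ - a 0 : ℝ) : ℂ) * s (n + 1) =
      ∑ i ∈ Finset.range (n + 1), ((a (i + 1) / (i + 1).factorial : ℝ) : ℂ) * s (n - i) := by
    intro n
    have h1 := hu (n + 1) n.succ_ne_zero
    rw [Finset.sum_range_succ', Nat.choose_zero_right, hf0, Nat.cast_one, one_mul,
      Nat.sub_zero, ← eq_neg_iff_add_eq_zero, ← neg_eq_iff_eq_neg,
      ← Finset.sum_neg_distrib] at h1
    have h2 : ((Λ - a 0 : ℝ) : ℂ) * s (n + 1) =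
        (-1) ^ (n + 1) / (n + 1).factorial * (((Λ : ℂ) - a 0) * u (n + 1)) := by
      rw [hs]; push_cast; ring
    rw [h2, ← h1, Finset.mul_sum]
    refine Finset.sum_congr rfl fun i hi => ?_
    have hin : i ≤ n := by have := Finset.mem_range.1 hi; omega
    obtain ⟨l, rfl⟩ := Nat.exists_eq_add_of_le hin
    have e1 : i + l + 1 - (i + 1) = l := by omega
    have e2 : i + l - i = l := by omega
    rw [hf, e1, e2, hs]
    have e3 : ((i + l + 1).choose (i + 1) : ℂ) =
        (i + l + 1).factorial / ((i + 1).factorial * l.factorial) := by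
      rw [show i + l + 1 = (i + 1) + l by ring, Nat.cast_add_choose]
    rw [e3]
    have h3 : (((i + l + 1).factorial : ℕ) : ℂ) ≠ 0 := by
      exact_mod_cast Nat.factorial_ne_zero _
    have h4 : (((i + 1).factorial : ℕ) : ℂ) ≠ 0 := by exact_mod_cast Nat.factorial_ne_zero _
    have h5 : ((l.factorial : ℕ) : ℂ) ≠ 0 := by exact_mod_cast Nat.factorial_ne_zero _
    have h6 : ((-1 : ℂ)) ^ (i + l + 1) * (-1) ^ (i + 1) = (-1) ^ l := by
      rw [← pow_add, show i + l + 1 + (i + 1) = 2 * (i + 1) + l by ring, pow_add, pow_mul]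
      simp
    push_cast
    field_simp
    rw [← h6]
    ring
  have hreal : ∀ n, s n = ((s n).re : ℂ) ∧ 0 ≤ (s n).re := by
    intro n
    induction n using Nat.strong_induction_on with
    | _ n ih =>
      suffices H : ∃ t : ℝ, 0 ≤ t ∧ s n = t by
        obtain ⟨t, ht, h⟩ := H
        rw [h]
        exact ⟨by simp, by simpa using ht⟩
      rcases n with - | n
      · refine ⟨(Λ - a 0)⁻¹, inv_nonneg.2 hd.le, ?_⟩
        have : u 0 = (f 0)⁻¹ := eq_inv_of_mul_eq_one_right hu0
        simp [hs, this, hf0]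
      · refine ⟨(Λ - a 0)⁻¹ * ∑ i ∈ Finset.range (n + 1),
          a (i + 1) / (i + 1).factorial * (s (n - i)).re, ?_, ?_⟩
        · refine mul_nonneg (inv_nonneg.2 hd.le) (Finset.sum_nonneg fun i _ => ?_)
          exact mul_nonneg (div_nonneg (ha _) (by positivity)) (ih (n - i) (by omega)).2
        · have hd' : ((Λ - a 0 : ℝ) : ℂ) ≠ 0 := by exact_mod_cast hd.ne'
          rw [Complex.ofReal_mul, Complex.ofReal_inv, eq_inv_mul_iff_mul_eq₀ hd', hrec n,
            Complex.ofReal_sum]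
          refine Finset.sum_congr rfl fun i _ => ?_
          rw [Complex.ofReal_mul, ← (ih (n - i) (by omega)).1]
  have hnorm : ∀ n, ‖u n‖ / n.factorial = (s n).re := by
    intro n
    have h1 : ‖s n‖ = ‖u n‖ / n.factorial := by
      rw [hs]; simp
    rw [← h1, (hreal n).1, Complex.norm_real, Real.norm_of_nonneg (hreal n).2, Complex.ofReal_re]
  -- Only the summand carrying `a j` is kept, and `Λ - a 0 ≤ Λ`. Iterating `m` times gives the
  -- power.
  have hstep : ∀ n, a j / j.factorial / Λ * (s n).re ≤ (s (n + j)).re := by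
    intro n
    obtain ⟨l, rfl⟩ := Nat.exists_eq_add_of_le' hj
    have h1 : (Λ - a 0) * (s (n + l + 1)).re =
        ∑ i ∈ Finset.range (n + l + 1), a (i + 1) / (i + 1).factorial * (s (n + l - i)).re := by
      have := congrArg Complex.re (hrec (n + l))
      rw [Complex.re_ofReal_mul, Complex.re_sum] at this
      simpa only [Complex.re_ofReal_mul] using this
    have h2 : a (l + 1) / (l + 1).factorial * (s (n + l - l)).re ≤
        (Λ - a 0) * (s (n + l + 1)).re := by
      rw [h1]
      exact Finset.single_le_sum (f := fun i => a (i + 1) / (i + 1).factorial * (s (n + l - i)).re)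
        (fun i _ => mul_nonneg (div_nonneg (ha _) (by positivity)) (hreal _).2)
        (Finset.mem_range.2 (by omega))
    rw [Nat.add_sub_cancel] at h2
    rw [div_mul_eq_mul_div, div_le_iff₀ hΛ0, ← add_assoc]
    nlinarith [mul_nonneg (ha 0) (hreal (n + l + 1)).2]
  rw [hnorm]
  have hb : 0 ≤ a j / j.factorial / Λ := div_nonneg (div_nonneg (ha _) (by positivity)) hΛ0.le
  induction m with
  | zero =>
    have : (s 0).re = (Λ - a 0)⁻¹ := by
      have : u 0 = (f 0)⁻¹ := eq_inv_of_mul_eq_one_right hu0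
      have : s 0 = (((Λ - a 0)⁻¹ : ℝ) : ℂ) := by simp [hs, this, hf0]
      rw [this, Complex.ofReal_re]
    rw [mul_zero, this, pow_zero, one_div]
    exact inv_anti₀ hd (by linarith [ha 0])
  | succ m ih =>
    rw [Nat.mul_succ]
    refine le_trans ?_ (hstep (j * m))
    rw [pow_succ']
    calc _ = a j / j.factorial / Λ * ((a j / j.factorial / Λ) ^ m / Λ) := by ring
      _ ≤ _ := by gcongr

theorem iterate_zderiv_const_sub (c : ℂ) (f : LogSurface → ℂ) (j : ℕ) :
    zderiv^[j + 1] (fun z => c - f z) = -zderiv^[j + 1] f := by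
  induction j with
  | zero =>
    funext z
    simp [zderiv]
  | succ j ih =>
    rw [Function.iterate_succ_apply', ih, Function.iterate_succ_apply' zderiv (j + 1)]
    funext z
    simp only [zderiv, Pi.neg_apply]
    rw [deriv.fun_neg]
    ring

/-! ### Inverse-closedness implies the root almost increasing property -/

theorem WeightMatrix.HasRai.of_inverseClosed {M : WeightMatrix} {α : ℝ} (hα : 1 < α)
    (hM : ∀ p : Index, ∃ αp : ℝ, α < αp ∧ ∃ L : ℕ → ℝ, (∀ j, 0 < L j) ∧ LogConvex L ∧
      Equivalent (fun j => gevreyBar (1 - αp) j * M.seq p j) L)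
    (hinv : InverseClosed M α) : M.HasRai := by
  intro p
  obtain ⟨a, ha, L, hLpos, hL, ⟨A, B, hA, hB, hML⟩, A', B', hA', hB', hLM⟩ := hM p
  obtain ⟨f, hf, ⟨C, h, hC, hh, hfb⟩, r, hr, hr0, c, h', hc, hh', hlow⟩ :=
    exists_characteristic_function hα ha hLpos hL
  have hgev : ∀ j, gevreyBar (a - 1) j * gevreyBar (1 - a) j = 1 := fun j => by
    rw [show 1 - a = -(a - 1) by ring]; exact gevreyBar_mul_gevreyBar_neg _ _
  have hfM : ∀ z ∈ sector α, ∀ j, ‖(zderiv^[j] f) z‖ ≤ C * A' * (h * B') ^ j * M.seq p j := by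
    intro z hz j
    have h1 := gevreyBar_pos (a - 1) j
    calc _ ≤ C * h ^ j * (gevreyBar (a - 1) j * L j) := hfb z hz j
      _ ≤ C * h ^ j * (gevreyBar (a - 1) j *
          (A' * B' ^ j * (gevreyBar (1 - a) j * M.seq p j))) := by gcongr; exact hLM j
      _ = C * A' * (h * B') ^ j * M.seq p j * (gevreyBar (a - 1) j * gevreyBar (1 - a) j) := by
          rw [mul_pow]; ring
      _ = _ := by rw [hgev, mul_one]
  have hlowM : ∀ j, ∃ x, c / A * (h' / B) ^ j * M.seq p j ≤ r j x := by
    intro j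
    obtain ⟨x, hx⟩ := hlow j
    refine ⟨x, le_trans ?_ hx⟩
    have h1 := gevreyBar_pos (a - 1) j
    calc c / A * (h' / B) ^ j * M.seq p j = c / A * (h' / B) ^ j *
          (gevreyBar (a - 1) j * (gevreyBar (1 - a) j * M.seq p j)) := by
          rw [← mul_assoc (gevreyBar _ _), hgev, one_mul]
      _ ≤ c / A * (h' / B) ^ j * (gevreyBar (a - 1) j * (A * B ^ j * L j)) := by
          have h2 : gevreyBar (1 - a) j * M.seq p j ≤ A * B ^ j * L j := hML j
          exact mul_le_mul_of_nonneg_left (mul_le_mul_of_nonneg_left h2 h1.le) (by positivity)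
      _ = _ := by rw [div_pow]; field_simp
  -- Since `|f| ≤ C * A'` on the sector, `Λ - f` has modulus at least `1`.
  set Λ : ℝ := C * A' + 1 with hΛ
  have hΛ0 : 0 < Λ := by positivity
  have hf0 : ∀ z ∈ sector α, ‖f z‖ ≤ C * A' := fun z hz => by
    simpa [M.zero] using hfM z hz 0
  have hF : HolomorphicOn (fun z => (Λ : ℂ) - f z) (sector α) := DifferentiableOn.const_sub hf _
  have hFmem : (fun z => (Λ : ℂ) - f z) ∈ classMatrix M (sector α) := by
    refine mem_classMatrix_iff.2 ⟨hF, p, Λ + C * A', h * B', by positivity, by positivity,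
      fun z hz j => ?_⟩
    rcases j with - | j
    · simp only [Function.iterate_zero, id, pow_zero, mul_one, M.zero]
      refine (norm_sub_le _ _).trans ?_
      rw [Complex.norm_real, Real.norm_of_nonneg hΛ0.le]
      linarith [hf0 z hz]
    · rw [iterate_zderiv_const_sub, Pi.neg_apply, norm_neg]
      refine (hfM z hz (j + 1)).trans ?_
      have := M.pos p (j + 1)
      gcongr
      linarith
  have hFlow : ∀ z ∈ sector α, 1 ≤ ‖(Λ : ℂ) - f z‖ := fun z hz => by
    have h1 := norm_sub_norm_le (Λ : ℂ) (f z)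
    rw [Complex.norm_real, Real.norm_of_nonneg hΛ0.le] at h1
    linarith [hf0 z hz]
  obtain ⟨hu, q, C₂, h₂, hC₂, hh₂, hub⟩ :=
    mem_classMatrix_iff.1 (hinv _ hFmem ⟨1, one_pos, hFlow⟩)
  set u : LogSurface → ℂ := fun z => 1 / ((Λ : ℂ) - f z) with hudef
  have hFu : ∀ z ∈ sector α, ((Λ : ℂ) - f z) * u z = 1 := fun z hz => by
    have : (Λ : ℂ) - f z ≠ 0 := by
      rw [← norm_pos_iff]; linarith [hFlow z hz]
    rw [hudef]; field_simp
  have hreal : ∀ x : ℝ, (⟨(x : ℂ)⟩ : LogSurface) ∈ sector α := fun x => by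
    change |(x : ℂ).im| < _
    rw [Complex.ofReal_im, abs_zero]
    have := Real.pi_pos
    positivity
  -- The point `x` where the `j`-th derivative is large varies with `j`, but the bounds for `u` are
  -- uniform on the sector, so the inequality no longer sees it.
  have key : ∀ j m : ℕ, 1 ≤ j →
      (c / A * (h' / B) ^ j * check (M.seq p) j / Λ) ^ m / Λ ≤
        C₂ * h₂ ^ (j * m) * check (M.seq q) (j * m) := by
    intro j m hj
    obtain ⟨x, hx⟩ := hlowM j
    have h0 : f ⟨x⟩ = r 0 x := by simpa using hr 0 x
    have hr0Λ : r 0 x < Λ := by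
      have h1 := hf0 _ (hreal x)
      rw [h0, Complex.norm_real, Real.norm_of_nonneg (hr0 _ _)] at h1
      linarith
    have h1 := pow_div_le_norm_of_reciprocal (a := fun i => r i x) (fun i => hr0 i x) hr0Λ
      (f := fun i => (zderiv^[i] fun z => (Λ : ℂ) - f z) ⟨x⟩) (u := fun i => (zderiv^[i] u) ⟨x⟩)
      (by simp [h0]) (fun i => by
        rw [iterate_zderiv_const_sub, Pi.neg_apply, hr]) (hFu _ (hreal x))
      (fun n hn => sum_choose_mul_zderiv_eq_zero hF hu (isOpen_sector α) hFu (hreal x) hn) hj m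
    have h2 := hub _ (hreal x) (j * m)
    have h3 := check_pos (M.pos p) j
    calc _ ≤ (r j x / j.factorial / Λ) ^ m / Λ := by
          gcongr
          rw [check, ← mul_div_assoc]
          gcongr
      _ ≤ _ := h1
      _ ≤ C₂ * h₂ ^ (j * m) * M.seq q (j * m) / (j * m).factorial := by gcongr
      _ = _ := by rw [check, mul_div_assoc]
  obtain ⟨aq, haq, Lq, hLqpos, hLq, hEq⟩ := hM q
  rw [show 1 - aq = -(aq - 1) by ring] at hEq
  obtain ⟨D, hD⟩ := exists_log_check_div_le_of_equivalent (by linarith) (M.pos q) hLqpos hLq hEq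
  have hposp := check_pos (M.pos p)
  have hposq := check_pos (M.pos q)
  have hlog : ∀ j m : ℕ, 1 ≤ j → 1 ≤ m → Real.log (check (M.seq p) j) / j ≤
      |Real.log (C₂ * Λ)| + Real.log h₂ + |Real.log (A * Λ / c)| + Real.log (B / h') +
        Real.log (check (M.seq q) (j * m)) / (j * m : ℕ) := by
    intro j m hj hm
    have h1 := key j m hj
    set y := c / A * (h' / B) ^ j * check (M.seq p) j / Λ with hy
    have hy0 : 0 < y := by have := hposp j; positivity
    have h2 : y ^ m ≤ C₂ * Λ * h₂ ^ (j * m) * check (M.seq q) (j * m) := by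
      rw [div_le_iff₀ hΛ0] at h1
      linarith
    have h3 := log_div_le_of_le_mul_pow (Nat.mul_pos hj hm) (pow_pos hy0 m) (hposq _)
      (by positivity) hh₂ h2
    have h4 : check (M.seq p) j ≤ A * Λ / c * (B / h') ^ j * y := by
      rw [hy, div_pow, div_pow]
      refine le_of_eq ?_
      field_simp
    have h5 := log_div_le_of_le_mul_pow hj (hposp j) hy0 (by positivity) (by positivity) h4
    have h6 : Real.log (y ^ m) / (j * m : ℕ) = Real.log y / j := by
      have : (0 : ℝ) < m := by exact_mod_cast hm
      have : (0 : ℝ) < j := by exact_mod_cast hj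
      rw [Real.log_pow]; push_cast; field_simp
    rw [h6] at h3
    linarith
  refine ⟨Real.exp (|Real.log (C₂ * Λ)| + Real.log h₂ + |Real.log (A * Λ / c)| +
    Real.log (B / h') + D), Real.exp_pos _, q, fun j k hj hjk => ?_⟩
  -- With `m = ⌊k / j⌋` the multiple `j m` satisfies `j m ≤ k ≤ 2 j m`, so the almost monotonicity
  -- of the roots of `check M^(q)` passes from `j m` to `k`.
  have hm : 1 ≤ k / j := (Nat.one_le_div_iff hj).2 hjk
  have h1 := hlog j (k / j) hj hm
  have h2 : j * (k / j) ≤ k := Nat.mul_div_le k j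
  have h3 : j ≤ j * (k / j) := Nat.le_mul_of_pos_right j hm
  have h4 : k ≤ 2 * (j * (k / j)) := by
    have := Nat.div_add_mod k j
    have := Nat.mod_lt k hj
    omega
  have h5 := hD (j * (k / j)) k (hj.trans h3) h2 h4
  rw [Real.rpow_def_of_pos (hposp j), Real.rpow_def_of_pos (hposq k), ← Real.exp_add,
    Real.exp_le_exp, mul_one_div, mul_one_div]
  linarith

end Ultraholomorphic

theorem mainTheorem2 (M : Ultraholomorphic.WeightMatrix) (α : ℝ) (hα : 1 < α)
    (hM : ∀ p : Ultraholomorphic.Index, ∃ αp : ℝ, α < αp ∧ ∃ L : ℕ → ℝ,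
      (∀ j, 0 < L j) ∧ Ultraholomorphic.LogConvex L ∧
        Ultraholomorphic.Equivalent
          (fun j => Ultraholomorphic.gevreyBar (1 - αp) j * M.seq p j) L) :
    List.TFAE [M.HasRai, Ultraholomorphic.HolomorphicallyClosed M α,
      Ultraholomorphic.InverseClosed M α] ∧
    (M.HasComega → M.HasDc →
      List.TFAE [M.HasRai, Ultraholomorphic.HolomorphicallyClosed M α,
        Ultraholomorphic.InverseClosed M α, Ultraholomorphic.ClosedUnderComposition M α,
        M.HasFdB]) := by
  have hab : M.HasRai → Ultraholomorphic.HolomorphicallyClosed M α := fun h => .of_hasRai h α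
  have hbc : Ultraholomorphic.HolomorphicallyClosed M α → Ultraholomorphic.InverseClosed M α :=
    .of_holomorphicallyClosed
  have hca : Ultraholomorphic.InverseClosed M α → M.HasRai := .of_inverseClosed hα hM
  refine ⟨?_, fun hω hdc => ?_⟩
  · tfae_have 1 → 2 := hab
    tfae_have 2 → 3 := hbc
    tfae_have 3 → 1 := hca
    tfae_finish
  · tfae_have 1 → 2 := hab
    tfae_have 2 → 3 := hbc
    tfae_have 3 → 1 := hca
    tfae_have 1 → 5 := fun h => h.hasFdB hdc
    tfae_have 5 → 4 := fun h => .of_hasFdB h α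
    tfae_have 4 → 2 := fun h => .of_closedUnderComposition h hω
    tfae_finish
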